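/- For $n\ge 1$ let $A_n=\{x\in\mathbb{Z}^{n+1}:\sum_i x_i=0\}$ and $\alpha_n=\left(\frac1{n+1},\dots,\frac1{n+1},-\frac n{n+1}\right)\in\mathbb{R}^{n+1}$. In the Euclidean space $\mathbb{R}^{10}\oplus\mathbb{R}^{10}\oplus\mathbb{R}^{2}$ let $L=A_9\oplus A_9\oplus A_1$, $\alpha=(\alpha_9,2\alpha_9,\alpha_1)$, $\Lambda=L+\mathbb{Z}\alpha$ and $r=(0,0,2\alpha_1)=(0,0,(1,-1))$. Let $X=\{\gamma\in\Lambda:(\gamma,\gamma)=3,\ (\gamma,r)=1\}$ and $X_m=X\cap(L+m\alpha)$ for $m\in\mathbb{Z}$. A finite set $\omega$ of vectors is an affine equiangular set with norm $3$ with respect to $r$ if $(u,r)=1$ and $(u,u)=3$ for all $u\in\omega$, and $(u,v)\in\{0,1\}$ for all distinct $u,v\in\omega$. For a subset $Y$ of the space, a maximum affine equiangular set in $Y$ is such a set contained in $Y$ of the largest possible cardinality. Let $\mathcal{X}$, $\mathcal{X}_1$, $\mathcal{X}_5$ be the sets of maximum affine equiangular sets (with norm $3$ with respect to $r$) in $X$,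 $X_1$, $X_5$, respectively. Two such sets $\omega,\omega'$ are switching equivalent, $\omega\sim_{\mathrm{sw}}\omega'$, if there is a bijection $g:\omega\to\omega'$ such that for each $u\in\omega$ either $g(u)=u$ or $g(u)=r-u$. Then $$|\mathcal{X}/{\sim_{\mathrm{sw}}}|\ \ge\ 3251173299978240000 .$$ Moreover $|\mathcal{X}_5/{\sim_{\mathrm{sw}}}|=151200$ and $|\mathcal{X}_1|\ge 9!\cdot T(10)\cdot 6240$, where $T(10)$ is the number of matchings (including the empty one) in the complete graph $K_{10}$, and $151200\cdot\bigl(9!\cdot T(10)\cdot 6240\bigr)=3251173299978240000$. -/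

import Mathlib

open scoped RealInnerProductSpace

section General

variable {V : Type*} [NormedAddCommGroup V] [InnerProductSpace ℝ V]

/-- `ω` is an affine equiangular set with norm `s` with respect to the root `r`. -/
structure IsAffineEquiangular (s : ℝ) (r : V) (ω : Set V) : Prop where
  one_le : 1 ≤ s
  root : ⟪r, r⟫ = 2
  finite : ω.Finite
  inner_root : ∀ u ∈ ω, ⟪u, r⟫ = 1
  inner_self : ∀ u ∈ ω, ⟪u, u⟫ = s
  inner_ne : ∀ u ∈ ω, ∀ v ∈ ω, u ≠ v → ⟪u, v⟫ = 0 ∨ ⟪u, v⟫ = 1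

/-- The affine equiangular sets with norm `s` with respect to `r` contained in `Y`
whose cardinality is the largest possible among such sets. -/
def maximumAES (s : ℝ) (r : V) (Y : Set V) : Set (Set V) :=
  {ω | (IsAffineEquiangular s r ω ∧ ω ⊆ Y) ∧
    ∀ ω' : Set V, IsAffineEquiangular s r ω' → ω' ⊆ Y → ω'.ncard ≤ ω.ncard}

end General

section Switching

variable {V : Type*} [AddCommGroup V]

/-- Switching equivalence: some vectors `u` may be replaced by `r - u`. -/
def SwitchingEquivalent (r : V) (ω ω' : Set V) : Prop :=
  ∃ g : ω ≃ ω', ∀ u : ω, (g u : V) = u ∨ (g u : V) = r - u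

theorem switchingEquivalent_equivalence (r : V) : Equivalence (SwitchingEquivalent r) where
  refl ω := ⟨Equiv.refl _, fun _ => Or.inl rfl⟩
  symm := by
    rintro ω ω' ⟨g, hg⟩
    refine ⟨g.symm, fun u => ?_⟩
    have h := hg (g.symm u)
    rw [Equiv.apply_symm_apply] at h
    rcases h with h | h
    · exact Or.inl h.symm
    · right
      rw [h]
      abel
  trans := by
    rintro ω ω' ω'' ⟨g, hg⟩ ⟨k, hk⟩
    refine ⟨g.trans k, fun u => ?_⟩
    rw [Equiv.trans_apply]
    rcases hg u with h | h <;> rcases hk (g u) with h' | h' <;> rw [h', h]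
    · exact Or.inl rfl
    · exact Or.inr rfl
    · exact Or.inr rfl
    · left
      abel

/-- Switching equivalence as a setoid on sets of vectors. -/
def switchingSetoid (r : V) : Setoid (Set V) where
  r := SwitchingEquivalent r
  iseqv := switchingEquivalent_equivalence r

/-- The set of switching classes of the members of a family `F` of sets of vectors. -/
abbrev SwitchingClasses (r : V) (F : Set (Set V)) : Type _ :=
  Quotient ((switchingSetoid r).comap (Subtype.val : F → Set V))

end Switching

noncomputable section Lattice

/-- The root lattice `A_n`: integer vectors of length `n + 1` with coordinate sum `0`. -/
def rootLatticeA (n : ℕ) : AddSubgroup (Fin (n + 1) → ℝ) where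
  carrier := {x | (∀ i, ∃ k : ℤ, x i = k) ∧ ∑ i, x i = 0}
  zero_mem' := ⟨fun _ => ⟨0, by simp⟩, by simp⟩
  add_mem' := by
    rintro x y ⟨hx, hx'⟩ ⟨hy, hy'⟩
    refine ⟨fun i => ?_, ?_⟩
    · obtain ⟨k, hk⟩ := hx i
      obtain ⟨l, hl⟩ := hy i
      exact ⟨k + l, by simp [hk, hl]⟩
    · simp [Finset.sum_add_distrib, hx', hy']
  neg_mem' := by
    rintro x ⟨hx, hx'⟩
    refine ⟨fun i => ?_, ?_⟩
    · obtain ⟨k, hk⟩ := hx i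
      exact ⟨-k, by simp [hk]⟩
    · simp [hx']

/-- The vector `(1/(n+1), …, 1/(n+1), -n/(n+1))`, a generator of `A_n^*/A_n`. -/
def alphaA (n : ℕ) : Fin (n + 1) → ℝ :=
  fun i => if i = Fin.last n then -((n : ℝ) / (n + 1)) else 1 / ((n : ℝ) + 1)

/-- The Euclidean space `ℝ¹⁰ ⊕ ℝ¹⁰ ⊕ ℝ²`. -/
abbrev Space : Type := EuclideanSpace ℝ (Fin 10 ⊕ Fin 10 ⊕ Fin 2)

/-- The vector `(x, y, z)`. -/
def triple (x y : Fin 10 → ℝ) (z : Fin 2 → ℝ) : Space :=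
  WithLp.toLp 2 (Sum.elim x (Sum.elim y z))

/-- The root lattice `L = A_9 ⊕ A_9 ⊕ A_1`. -/
def latticeL : AddSubgroup Space where
  carrier := {v | (fun i => v (Sum.inl i)) ∈ rootLatticeA 9 ∧
    (fun i => v (Sum.inr (Sum.inl i))) ∈ rootLatticeA 9 ∧
    (fun i => v (Sum.inr (Sum.inr i))) ∈ rootLatticeA 1}
  zero_mem' := ⟨zero_mem (rootLatticeA 9), zero_mem (rootLatticeA 9), zero_mem (rootLatticeA 1)⟩
  add_mem' := fun hx hy =>
    ⟨add_mem hx.1 hy.1, add_mem hx.2.1 hy.2.1, add_mem hx.2.2 hy.2.2⟩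
  neg_mem' := fun hx => ⟨neg_mem hx.1, neg_mem hx.2.1, neg_mem hx.2.2⟩

/-- The vector `α = (α_9, 2 α_9, α_1)`. -/
def alphaVec : Space := triple (alphaA 9) ((2 : ℝ) • alphaA 9) (alphaA 1)

/-- The lattice `Λ = L + ℤ α`. -/
def latticeLambda : AddSubgroup Space := latticeL ⊔ AddSubgroup.zmultiples alphaVec

/-- The switching root `r = (0, 0, 2 α_1) = (0, 0, (1, -1))`. -/
def switchingRoot : Space := triple 0 0 ((2 : ℝ) • alphaA 1)

/-- The set `X` of norm `3` vectors of `Λ` having inner product `1` with the switching root. -/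
def setX : Set Space :=
  {γ | γ ∈ latticeLambda ∧ ⟪γ, γ⟫ = (3 : ℝ) ∧ ⟪γ, switchingRoot⟫ = (1 : ℝ)}

/-- `X_m`, the part of `X` in the coset `L + m α`. -/
def setXm (m : ℤ) : Set Space := {γ ∈ setX | γ - m • alphaVec ∈ latticeL}

/-- The number `T(n)` of matchings (the empty one included) in the complete graph `K_n`. -/
def numMatchings (n : ℕ) : ℕ :=
  {M : (⊤ : SimpleGraph (Fin n)).Subgraph | M.IsMatching}.ncard

end Lattice

/-! In coordinates a vector of `X_m` is a pair of integer vectors with prescribed sums and total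
square norm. Modulo 10 only m = 1, 5, 9 occur. `X₁` consists of vectors (i, e) with i a point and e
an edge of K₁₀, with inner product [i = j] + |e ∩ f|. `X₅` consists of the five-subsets S of ten
points, with inner product |S ∩ T| - 2. The case m = 9 is the image of `X₁` under u ↦ r - u.

In `X₁` the edges of distinct members are distinct, and edges of the same colour are disjoint. A set
of the largest size 45 therefore contains the same data as a proper edge colouring of K₁₀ with at
most ten colours. Many colourings come from a one-factorization with part of one factor recoloured
by the tenth colour. Two factorizations without symmetries fixing that factor give 9! · T(10) · 2 ·
3840 of them (`le_card_properColoring`).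

In `X₅` switching is complementation, so switching classes are complement-closed families of
five-sets with intersections 2 or 3. Counting the members through each pair of points gives at most
twelve complementary pairs (`IsLineFamily.card_le`). In the extremal case it produces a unique
four-set P meeting every member in one or three points. Given P, the family amounts to four pairwise
disjoint perfect matchings of the K₆ on the other six points, indexed by the points of P. This gives
210 · 720 = 151200 families (`card_lineFamilies`).

Vectors of `X₁` and `X₅` always have inner product 0 or 1, so maximum sets in the two parts combine
freely into sets of the maximum size 57. No vector of `X₁` can be switched within `X₁ ∪ X₅`, so the
`X₁` part survives as a set and only the `X₅` part is taken up to switching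
(`mul_card_switchingClasses_le`). The bound is the product of the two counts. -/

/-! ### Proper edge colourings of K₁₀ from rigid one-factorizations. -/

/-- A proper edge colouring of the complete graph on `Fin 10` with colours in `Fin 10`, given as a
symmetric matrix whose diagonal carries the conventional value `9`. -/
structure IsProperColoring (c : Fin 10 → Fin 10 → Fin 10) : Prop where
  diag : ∀ a, c a a = 9
  symm : ∀ a b, c a b = c b a
  proper : ∀ a b b', a ≠ b → a ≠ b' → c a b = c a b' → b = b'

/-- The fixed point free involution `(0 1)(2 3)(4 5)(6 7)(8 9)`. -/
def pairing : Equiv.Perm (Fin 10) :=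
  Equiv.swap 0 1 * Equiv.swap 2 3 * Equiv.swap 4 5 * Equiv.swap 6 7 * Equiv.swap 8 9

/-- Two one-factorizations of `K₁₀`; colour `8` is the factor `pairing`, and `8` is also put
on the diagonal. -/
def oneFactorization : Fin 2 → Fin 10 → Fin 10 → Fin 9 :=
  ![![![8, 8, 0, 3, 6, 4, 5, 1, 7, 2], ![8, 8, 6, 4, 1, 2, 3, 7, 5, 0],
      ![0, 6, 8, 8, 7, 3, 4, 5, 2, 1], ![3, 4, 8, 8, 5, 7, 2, 0, 1, 6],
      ![6, 1, 7, 5, 8, 8, 0, 2, 4, 3], ![4, 2, 3, 7, 8, 8, 1, 6, 0, 5],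
      ![5, 3, 4, 2, 0, 1, 8, 8, 6, 7], ![1, 7, 5, 0, 2, 6, 8, 8, 3, 4],
      ![7, 5, 2, 1, 4, 0, 6, 3, 8, 8], ![2, 0, 1, 6, 3, 5, 7, 4, 8, 8]],
    ![![8, 8, 0, 1, 3, 2, 5, 7, 4, 6], ![8, 8, 7, 6, 5, 3, 0, 4, 1, 2],
      ![0, 7, 8, 8, 1, 6, 4, 2, 3, 5], ![1, 6, 8, 8, 4, 0, 3, 5, 2, 7],
      ![3, 5, 1, 4, 8, 8, 2, 6, 7, 0], ![2, 3, 6, 0, 8, 8, 7, 1, 5, 4],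
      ![5, 0, 4, 3, 2, 7, 8, 8, 6, 1], ![7, 4, 2, 5, 6, 1, 8, 8, 0, 3],
      ![4, 1, 3, 2, 7, 5, 6, 0, 8, 8], ![6, 2, 5, 7, 0, 4, 1, 3, 8, 8]]]

theorem oneFactorization_symm : ∀ k a b, oneFactorization k a b = oneFactorization k b a := by
  decide +kernel

theorem oneFactorization_proper : ∀ k a b b', a ≠ b → a ≠ b' →
    oneFactorization k a b = oneFactorization k a b' → b = b' := by
  decide +kernel

theorem oneFactorization_eq_eight_iff : ∀ k a b,
    oneFactorization k a b = 8 ↔ a = b ∨ pairing a = b := by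
  decide +kernel

theorem exists_oneFactorization_eq : ∀ k, ∀ c : Fin 9, c ≠ 8 → ∃ b, oneFactorization k 0 b = c := by
  decide +kernel

/-- The number of two-coloured closed walks of length four through `v` avoiding colour `8`. -/
def cycleCount (k : Fin 2) (v : Fin 10) : ℕ :=
  (Finset.univ.filter fun p : Fin 10 × Fin 10 × Fin 10 =>
    (oneFactorization k v p.1 ≠ 8 ∧ oneFactorization k v p.1 = oneFactorization k p.2.1 p.2.2) ∧
    oneFactorization k p.1 p.2.1 ≠ 8 ∧ oneFactorization k p.1 p.2.1 = oneFactorization k p.2.2 v).card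

theorem cycleCount_eq : ∀ k v, cycleCount k v =
    ![![12, 20, 8, 22, 22, 10, 12, 16, 20, 18], ![10, 22, 12, 20, 24, 18, 12, 22, 12, 16]] k v := by
  decide +kernel

/-- The counts alone have ties; the count at the partner under `pairing` breaks every one of them.
-/
theorem eq_of_cycleCount_eq : ∀ k v w, cycleCount k v = cycleCount k w →
    cycleCount k (pairing v) = cycleCount k (pairing w) → v = w := by
  simp only [cycleCount_eq]
  decide +kernel

/-- The totals are 160 and 168, which tells the two factorizations apart. -/
theorem sum_cycleCount_injective :
    Function.Injective fun k => ∑ v, cycleCount k v := by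
  simp only [cycleCount_eq]
  decide +kernel

/-- The two one-factorizations have no common symmetries that fix colour `8`. -/
theorem oneFactorization_rigid {k k' : Fin 2} {ρ : Equiv.Perm (Fin 9)} {μ : Equiv.Perm (Fin 10)}
    (hμ : ∀ a, μ (pairing a) = pairing (μ a))
    (h : ∀ a b, oneFactorization k a b ≠ 8 →
      ρ (oneFactorization k a b) = oneFactorization k' (μ a) (μ b)) :
    k = k' ∧ μ = 1 ∧ ρ = 1 := by
  have h8 : ∀ a b, oneFactorization k a b ≠ 8 ↔ oneFactorization k' (μ a) (μ b) ≠ 8 := by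
    intro a b
    rw [Ne, Ne, oneFactorization_eq_eight_iff, oneFactorization_eq_eight_iff, ← hμ,
      μ.injective.eq_iff, μ.injective.eq_iff]
  have key : ∀ a b c d, (oneFactorization k a b ≠ 8 ∧ oneFactorization k a b = oneFactorization k c d) ↔
      (oneFactorization k' (μ a) (μ b) ≠ 8 ∧
        oneFactorization k' (μ a) (μ b) = oneFactorization k' (μ c) (μ d)) := by
    intro a b c d
    constructor
    · rintro ⟨h1, h2⟩
      refine ⟨(h8 a b).1 h1, ?_⟩
      rw [← h a b h1, ← h c d (h2 ▸ h1), h2]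
    · rintro ⟨h1, h2⟩
      have h1' := (h8 a b).2 h1
      have h2' := (h8 c d).2 (h2 ▸ h1)
      refine ⟨h1', ρ.injective ?_⟩
      rw [h a b h1', h c d h2', h2]
  have hc : ∀ v, cycleCount k v = cycleCount k' (μ v) := by
    intro v
    refine Finset.card_equiv (Equiv.prodCongr μ (Equiv.prodCongr μ μ)) ?_
    rintro ⟨x, y, z⟩
    simp only [Finset.mem_filter, Finset.mem_univ, true_and, Equiv.prodCongr_apply, Prod.map_apply]
    rw [key, key]
  have hk : k = k' := by
    apply sum_cycleCount_injective
    simp only [hc]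
    exact Equiv.sum_comp μ (cycleCount k')
  subst hk
  have hμ1 : μ = 1 := by
    ext1 v
    refine (eq_of_cycleCount_eq k v (μ v) (hc v) ?_).symm
    rw [← hμ]
    exact hc _
  subst hμ1
  refine ⟨rfl, rfl, ?_⟩
  have h9 : ∀ c, c ≠ 8 → ρ c = c := by
    intro c hc
    obtain ⟨b, hb⟩ := exists_oneFactorization_eq k c hc
    have := h 0 b (hb ▸ hc)
    rw [hb] at this
    simpa [hb] using this
  ext1 c
  -- All other colours are fixed, so injectivity leaves no other image for colour 8.
  by_cases hc : c = 8
  · by_contra hne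
    have : ρ c ≠ 8 := fun h => hne (by rw [h, hc]; rfl)
    have := ρ.injective (h9 _ this)
    exact hne this
  · exact h9 c hc

/-- An involution is a product of at most five disjoint transpositions, hence conjugate to an
initial part of the product defining `pairing`. Thus every matching lies in a conjugate of the
perfect matching `pairing`. -/
theorem exists_perm_extending {t : Equiv.Perm (Fin 10)} (ht : t ^ 2 = 1) :
    ∃ σ : Equiv.Perm (Fin 10), ∀ x, t x ≠ x → t x = σ (pairing (σ⁻¹ x)) := by
  have h2 : Fact (Nat.Prime 2) := ⟨Nat.prime_two⟩
  have hct := Equiv.Perm.pow_prime_eq_one_iff.1 ht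
  obtain ⟨s, hs, hs2⟩ : ∃ s : Equiv.Perm (Fin 10), s.cycleType = t.cycleType ∧
      ∀ x, s x ≠ x → s x = pairing x := by
    have hrep := Multiset.eq_replicate_card.2 hct
    have hle : 2 * Multiset.card t.cycleType ≤ 10 := by
      have := t.sum_cycleType_le
      rw [hrep, Multiset.sum_replicate] at this
      simp at this
      omega
    generalize Multiset.card t.cycleType = m at hrep hle
    rw [hrep]
    have hm : m ≤ 5 := by omega
    interval_cases m
    · exact ⟨1, by decide +kernel, by decide +kernel⟩
    · exact ⟨Equiv.swap 0 1, by decide +kernel, by decide +kernel⟩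
    · exact ⟨Equiv.swap 0 1 * Equiv.swap 2 3, by decide +kernel, by decide +kernel⟩
    · exact ⟨Equiv.swap 0 1 * Equiv.swap 2 3 * Equiv.swap 4 5, by decide +kernel, by decide +kernel⟩
    · exact ⟨Equiv.swap 0 1 * Equiv.swap 2 3 * Equiv.swap 4 5 * Equiv.swap 6 7,
        by decide +kernel, by decide +kernel⟩
    · exact ⟨pairing, by decide +kernel, by decide +kernel⟩
  obtain ⟨σ, hσ⟩ := isConj_iff.1 (Equiv.Perm.isConj_iff_cycleType_eq.2 hs)
  refine ⟨σ, fun x hx => ?_⟩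
  subst hσ
  simp only [Equiv.Perm.mul_apply] at hx ⊢
  congr 1
  apply hs2
  intro h
  apply hx
  rw [h]
  simp

/-- The centralizer permutes the five pairs and flips each of them: 2⁵ · 5! = 3840. -/
theorem card_centralizer_pairing :
    Nat.card (Subgroup.centralizer ({pairing} : Set (Equiv.Perm (Fin 10)))) = 3840 := by
  have h : pairing.cycleType = Multiset.replicate 5 2 := by decide +kernel
  rw [Equiv.Perm.nat_card_centralizer, h]
  decide +kernel

-- The parameters are the matching t that receives the tenth colour, one of two factorizations, a
-- relabelling of the points commuting with `pairing`, and a permutation of the nine colours. The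
-- colouring determines t as the class of colour 9; rigidity then recovers the rest. The factor 7680
-- is 2 · 3840.
open Classical in
theorem le_card_properColoring :
    Nat.factorial 9 * Nat.card {t : Equiv.Perm (Fin 10) // t ^ 2 = 1} * 7680 ≤
      Nat.card {c // IsProperColoring c} := by
  choose σ hσ using fun t : {t : Equiv.Perm (Fin 10) // t ^ 2 = 1} => exists_perm_extending t.2
  have inv_self : ∀ {n : ℕ} (e : Equiv.Perm (Fin n)) x, e⁻¹ (e x) = x :=
    fun e x => Equiv.symm_apply_apply e x
  let C := Subgroup.centralizer ({pairing} : Set (Equiv.Perm (Fin 10)))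
  -- The conjugation by `σ t` places the edges of t inside the factor of colour 8; these edges are
  -- recoloured 9, which `castSucc` never produces.
  let col : {t : Equiv.Perm (Fin 10) // t ^ 2 = 1} → Fin 2 → C → Equiv.Perm (Fin 9) →
      Fin 10 → Fin 10 → Fin 10 := fun t k τ π a b =>
    if a = b ∨ t.1 a = b then 9 else
      (π (oneFactorization k ((σ t * τ.1)⁻¹ a) ((σ t * τ.1)⁻¹ b))).castSucc
  have ht : ∀ t : {t : Equiv.Perm (Fin 10) // t ^ 2 = 1}, ∀ a b, t.1 a = b ↔ t.1 b = a := by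
    intro t a b
    have h : ∀ x, t.1 (t.1 x) = x := fun x => by
      rw [← Equiv.Perm.mul_apply, ← sq, t.2]; rfl
    constructor <;> rintro rfl <;> exact h _
  have h9 : ∀ t k τ π a b, col t k τ π a b = 9 ↔ a = b ∨ t.1 a = b := by
    intro t k τ π a b
    simp only [col]
    split_ifs with h
    · simp [h]
    · simp only [h, iff_false]
      exact (Fin.castSucc_lt_last _).ne
  have hproper : ∀ t k τ π, IsProperColoring (col t k τ π) := by
    intro t k τ π
    refine ⟨fun a => by simp [col], fun a b => ?_, fun a b b' hb hb' h => ?_⟩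
    · simp only [col, eq_comm (a := a) (b := b), ht t a b, oneFactorization_symm k]
    · by_cases h1 : t.1 a = b
      · have := (h9 t k τ π a b).2 (Or.inr h1)
        rw [h, h9] at this
        rcases this with h2 | h2
        · exact absurd h2 hb'
        · rw [← h1, h2]
      · by_cases h2 : t.1 a = b'
        · have := (h9 t k τ π a b').2 (Or.inr h2)
          rw [← h, h9] at this
          rcases this with h3 | h3
          · exact absurd h3 hb
          · exact absurd h3 h1
        · simp only [col, hb, h1, hb', h2, or_self, if_false] at h
          have h3 := π.injective (Fin.castSucc_injective _ h)
          have := oneFactorization_proper k _ _ _ (fun e => hb (Equiv.injective _ e))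
            (fun e => hb' (Equiv.injective _ e)) h3
          exact Equiv.injective _ this
  let F : {t : Equiv.Perm (Fin 10) // t ^ 2 = 1} × Fin 2 × C × Equiv.Perm (Fin 9) →
      {c // IsProperColoring c} := fun p => ⟨col p.1 p.2.1 p.2.2.1 p.2.2.2, hproper _ _ _ _⟩
  have hF : Function.Injective F := by
    rintro ⟨t, k, τ, π⟩ ⟨t', k', τ', π'⟩ h
    have hcol : ∀ a b, col t k τ π a b = col t' k' τ' π' a b := by
      intro a b
      exact congrFun (congrFun (congrArg Subtype.val h) a) b
    have htt : t = t' := by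
      apply Subtype.ext
      ext1 a
      have h1 := hcol a (t.1 a)
      rw [(h9 _ _ _ _ _ _).2 (Or.inr rfl), eq_comm, h9] at h1
      have h2 := hcol a (t'.1 a)
      rw [(h9 t' _ _ _ _ _).2 (Or.inr rfl), h9] at h2
      rcases h1 with h1 | h1
      · rcases h2 with h2 | h2
        · rw [← h1, ← h2]
        · exact h2
      · exact h1.symm
    subst htt
    have hτ : ∀ τ : C, ∀ a, τ.1 (pairing a) = pairing (τ.1 a) := by
      intro τ a
      have := Subgroup.mem_centralizer_singleton_iff.1 τ.2
      exact (congrArg (fun f : Equiv.Perm (Fin 10) => f a) this)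
    have key := oneFactorization_rigid (k := k) (k' := k') (ρ := π'⁻¹ * π) (μ := (τ'⁻¹ * τ).1)
      (hτ _) ?_
    · obtain ⟨h1, h2, h3⟩ := key
      have h2' : τ'⁻¹ * τ = 1 := Subtype.ext h2
      rw [inv_mul_eq_one] at h2' h3
      rw [h1, h2', h3]
    · intro a b hab
      have hab' := hab
      rw [Ne, oneFactorization_eq_eight_iff, not_or] at hab'
      have h1 := hcol (σ t (τ.1 a)) (σ t (τ.1 b))
      -- Edges of t come from the factor `pairing` alone, so an edge of any other colour escapes
      -- recolouring, and the hypotheses of the rigidity lemma can be read off from the two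
      -- colourings.
      have hn : ¬ (σ t (τ.1 a) = σ t (τ.1 b) ∨ t.1 (σ t (τ.1 a)) = σ t (τ.1 b)) := by
        rintro (h2 | h2)
        · exact hab'.1 (Equiv.injective _ (Equiv.injective _ h2))
        · have h3 := hσ t (σ t (τ.1 a)) (by
            rw [h2]
            exact fun e => hab'.1 (Equiv.injective _ (Equiv.injective _ e.symm)))
          rw [h2] at h3
          have h4 := Equiv.injective _ h3
          rw [inv_self] at h4
          rw [← hτ] at h4
          exact hab'.2 (Equiv.injective _ h4.symm)
      simp only [col, hn, if_false] at h1
      have h2 := Fin.castSucc_injective _ h1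
      simp only [mul_inv_rev, Equiv.Perm.mul_apply, inv_self] at h2
      rw [Equiv.Perm.mul_apply, h2]
      exact inv_self _ _
  have := Nat.card_le_card_of_injective F hF
  simp only [Nat.card_prod, C, card_centralizer_pairing, Nat.card_perm, Nat.card_eq_fintype_card (α := Fin _),
    Fintype.card_fin] at this
  calc _ = _ := by ring
    _ ≤ _ := this

/-! ### Involutions and matchings. -/

theorem Equiv.Perm.card_sq_eq_one_fin_ten :
    Nat.card {t : Equiv.Perm (Fin 10) // t ^ 2 = 1} = 9496 := by
  classical
  have h2 : Fact (Nat.Prime 2) := ⟨Nat.prime_two⟩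
  rw [Nat.card_eq_fintype_card, Fintype.card_subtype]
  have h : (Finset.univ.filter fun t : Equiv.Perm (Fin 10) => t ^ 2 = 1) =
      (Finset.range 6).biUnion fun m =>
        Finset.univ.filter fun t : Equiv.Perm (Fin 10) => t.cycleType = Multiset.replicate m 2 := by
    ext t
    simp only [Finset.mem_filter, Finset.mem_univ, true_and, Finset.mem_biUnion, Finset.mem_range]
    rw [Equiv.Perm.pow_prime_eq_one_iff]
    constructor
    · intro hct
      have hrep := Multiset.eq_replicate_card.2 hct
      refine ⟨_, ?_, hrep⟩
      have := t.sum_cycleType_le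
      rw [hrep, Multiset.sum_replicate] at this
      simp at this
      omega
    · rintro ⟨m, -, hm⟩ c hc
      rw [hm] at hc
      exact Multiset.eq_of_mem_replicate hc
  rw [h, Finset.card_biUnion]
  · have hm : ∀ m ∈ Finset.range 6,
        (Finset.univ.filter fun t : Equiv.Perm (Fin 10) => t.cycleType = Multiset.replicate m 2).card
          = Nat.factorial 10 / (Nat.factorial (10 - 2 * m) * 2 ^ m * Nat.factorial m) := by
      intro m hm
      have hm' : m < 6 := Finset.mem_range.1 hm
      rw [Equiv.Perm.card_of_cycleType]
      interval_cases m <;> simp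
    rw [Finset.sum_congr rfl hm]
    decide +kernel
  · intro a _ b _ hab
    rw [Function.onFun, Finset.disjoint_left]
    intro t ha hb
    simp only [Finset.mem_filter, Finset.mem_univ, true_and] at ha hb
    exact hab (Multiset.replicate_left_injective 2 (ha ▸ hb))

/-- An involution swaps matched points and fixes the others. `IsMatching` forces the vertex set of
the subgraph to be exactly the matched points, so no isolated vertices inflate the count. -/
theorem numMatchings_eq (n : ℕ) :
    numMatchings n = Nat.card {t : Equiv.Perm (Fin n) // t ^ 2 = 1} := by
  classical
  symm
  rw [numMatchings, ← Nat.card_coe_set_eq]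
  have hinv : ∀ t : {t : Equiv.Perm (Fin n) // t ^ 2 = 1}, ∀ x, t.1 (t.1 x) = x := fun t x => by
    rw [← Equiv.Perm.mul_apply, ← sq, t.2]; rfl
  let F : {t : Equiv.Perm (Fin n) // t ^ 2 = 1} →
      {M : (⊤ : SimpleGraph (Fin n)).Subgraph | M.IsMatching} := fun t =>
    ⟨{ verts := {x | t.1 x ≠ x}
       Adj := fun a b => a ≠ b ∧ t.1 a = b
       adj_sub := fun h => h.1
       edge_vert := fun {a b} h => by
         rw [Set.mem_ofPred_eq, h.2]
         exact h.1.symm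
       symm := ⟨fun a b h => ⟨h.1.symm, by rw [← h.2, hinv]⟩⟩ },
      fun v hv => ⟨t.1 v, ⟨fun h => hv h.symm, rfl⟩, fun w hw => hw.2.symm⟩⟩
  refine Nat.card_eq_of_bijective F ⟨fun t t' h => ?_, ?_⟩
  · have hAdj : ∀ a b, (a ≠ b ∧ t.1 a = b) ↔ (a ≠ b ∧ t'.1 a = b) := by
      intro a b
      exact iff_of_eq (congrArg (fun M : {M : (⊤ : SimpleGraph (Fin n)).Subgraph | M.IsMatching} =>
        M.1.Adj a b) h)
    apply Subtype.ext
    ext1 a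
    by_cases ha : t.1 a = a
    · by_contra hne
      have := (hAdj a (t'.1 a)).2 ⟨fun e => hne (by rw [ha, ← e]), rfl⟩
      exact hne this.2
    · exact ((hAdj a (t.1 a)).1 ⟨fun e => ha e.symm, rfl⟩).2.symm
  · rintro ⟨M, hM⟩
    let p : Fin n → Fin n := fun a => if h : a ∈ M.verts then (hM h).choose else a
    have hp : ∀ a, a ∈ M.verts → M.Adj a (p a) := by
      intro a ha
      simp only [p, dif_pos ha]
      exact (hM ha).choose_spec.1
    have hp' : ∀ a b, M.Adj a b → p a = b := by
      intro a b h
      have ha := M.edge_vert h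
      exact (hM ha).unique (hp a ha) h
    have hpp : Function.Involutive p := by
      intro a
      by_cases ha : a ∈ M.verts
      · exact hp' _ _ (hp a ha).symm
      · have : p a = a := by simp only [p, dif_neg ha]
        rw [this, this]
    refine ⟨⟨hpp.toPerm, ?_⟩, ?_⟩
    · ext1 a
      rw [sq, Equiv.Perm.mul_apply]
      exact hpp a
    · apply Subtype.ext
      have hne : ∀ a, p a ≠ a ↔ a ∈ M.verts := by
        intro a
        constructor
        · intro h
          by_contra ha
          exact h (by simp only [p, dif_neg ha])
        · intro ha h
          have := hp a ha
          rw [h] at this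
          exact M.loopless.irrefl a this
      ext a b
      · exact hne a
      · constructor
        · rintro ⟨h1, h2⟩
          have h2' : p a = b := h2
          have := hp a ((hne a).1 (by rw [h2']; exact h1.symm))
          rwa [h2'] at this
        · intro h
          exact ⟨h.ne, hp' _ _ h⟩

theorem numMatchings_ten : numMatchings 10 = 9496 := by
  rw [numMatchings_eq, Equiv.Perm.card_sq_eq_one_fin_ten]

/-! ### Complement-closed families of five-sets and their pair degrees. -/

/-- A family of `5`-subsets of `Fin 10`, closed under complements, in which any two members that
are neither equal nor complementary meet in two or three points. -/
structure IsLineFamily (W : Finset (Finset (Fin 10))) : Prop where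
  card_eq : ∀ S ∈ W, S.card = 5
  compl_mem : ∀ S ∈ W, Sᶜ ∈ W
  inter : ∀ S ∈ W, ∀ T ∈ W, T ≠ S → T ≠ Sᶜ → (S ∩ T).card = 2 ∨ (S ∩ T).card = 3

/-- The integer-valued indicator of a finset. -/
def ind (S : Finset (Fin 10)) (i : Fin 10) : ℤ := if i ∈ S then 1 else 0

/-- The number of members of `W` containing both `i` and `j`. -/
def pairDegree (W : Finset (Finset (Fin 10))) (i j : Fin 10) : ℤ := ∑ S ∈ W, ind S i * ind S j

theorem ind_compl (S : Finset (Fin 10)) (i : Fin 10) : ind Sᶜ i = 1 - ind S i := by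
  by_cases h : i ∈ S <;> simp [ind, h]

theorem ind_mul_self (S : Finset (Fin 10)) (i : Fin 10) : ind S i * ind S i = ind S i := by
  by_cases h : i ∈ S <;> simp [ind, h]

theorem sum_ind (S P : Finset (Fin 10)) : ∑ i ∈ P, ind S i = ((S ∩ P).card : ℤ) := by
  simp only [ind, Finset.sum_boole, Finset.inter_comm S P, Finset.filter_mem_eq_inter]

theorem sum_ind_mul_ind (S T : Finset (Fin 10)) : ∑ i, ind S i * ind T i = ((S ∩ T).card : ℤ) := by
  have : ∀ i, ind S i * ind T i = ind (S ∩ T) i := by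
    intro i
    by_cases h : i ∈ S <;> by_cases h' : i ∈ T <;> simp [ind, h, h']
  simp only [this, sum_ind, Finset.inter_univ]

theorem pairDegree_comm (W : Finset (Finset (Fin 10))) (i j : Fin 10) :
    pairDegree W i j = pairDegree W j i := by
  simp only [pairDegree, mul_comm]

theorem sum_pairDegree (W : Finset (Finset (Fin 10))) (P : Finset (Fin 10)) (i : Fin 10) :
    ∑ j ∈ P, pairDegree W i j = ∑ S ∈ W, ind S i * ((S ∩ P).card : ℤ) := by
  simp only [pairDegree]
  rw [Finset.sum_comm]
  simp only [← Finset.mul_sum, sum_ind]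

theorem sum_sum_pairDegree (W : Finset (Finset (Fin 10))) (P : Finset (Fin 10)) :
    ∑ i ∈ P, ∑ j ∈ P, pairDegree W i j = ∑ S ∈ W, ((S ∩ P).card : ℤ) ^ 2 := by
  simp only [sum_pairDegree]
  rw [Finset.sum_comm]
  simp only [← Finset.sum_mul, sum_ind, sq]

/-- With M the incidence matrix, both sides are the squared Frobenius norm of a Gram matrix, of MMᵀ
and of MᵀM. -/
theorem sum_sum_pairDegree_sq (W : Finset (Finset (Fin 10))) :
    ∑ i, ∑ j, pairDegree W i j ^ 2 = ∑ S ∈ W, ∑ T ∈ W, ((S ∩ T).card : ℤ) ^ 2 := by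
  have h : ∀ i j, pairDegree W i j ^ 2 =
      ∑ S ∈ W, ∑ T ∈ W, (ind S i * ind T i) * (ind S j * ind T j) := by
    intro i j
    rw [sq, pairDegree, Finset.sum_mul_sum]
    refine Finset.sum_congr rfl fun S _ => Finset.sum_congr rfl fun T _ => by ring
  simp only [h, ← sum_ind_mul_ind, sq, Finset.sum_mul_sum]
  calc _ = ∑ i, ∑ S ∈ W, ∑ T ∈ W, ∑ j, (ind S i * ind T i) * (ind S j * ind T j) := by
        refine Finset.sum_congr rfl fun i _ => ?_
        rw [Finset.sum_comm]
        refine Finset.sum_congr rfl fun S _ => ?_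
        rw [Finset.sum_comm]
    _ = _ := by
        rw [Finset.sum_comm]
        refine Finset.sum_congr rfl fun S _ => ?_
        rw [Finset.sum_comm]

theorem Finset.card_compl_inter_fin_ten (S P : Finset (Fin 10)) :
    ((Sᶜ ∩ P).card : ℤ) = P.card - (S ∩ P).card := by
  rw [← sum_ind, ← sum_ind]
  simp only [ind_compl, Finset.sum_sub_distrib, Finset.sum_const, nsmul_eq_mul, mul_one]

theorem Finset.sum_sum_erase {f : Fin 10 → Fin 10 → ℤ} :
    ∑ i, ∑ j ∈ Finset.univ.erase i, f i j = ∑ i, ∑ j, f i j - ∑ i, f i i := by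
  rw [← Finset.sum_sub_distrib]
  refine Finset.sum_congr rfl fun i _ => ?_
  rw [← Finset.sum_erase_add _ _ (Finset.mem_univ i)]
  ring

namespace IsLineFamily

variable {W : Finset (Finset (Fin 10))}

theorem sum_compl (hW : IsLineFamily W) (f : Finset (Fin 10) → ℤ) :
    ∑ S ∈ W, f Sᶜ = ∑ S ∈ W, f S := by
  refine Finset.sum_nbij' (fun S => Sᶜ) (fun S => Sᶜ) ?_ ?_ ?_ ?_ ?_
  · exact fun S hS => hW.compl_mem S hS
  · exact fun S hS => hW.compl_mem S hS
  · simp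
  · simp
  · simp

theorem ne_compl {S : Finset (Fin 10)} : S ≠ Sᶜ := by
  intro h
  have h0 : (0 : Fin 10) ∈ S ↔ (0 : Fin 10) ∈ Sᶜ := by rw [← h]
  simp at h0

theorem sum_ind_eq (hW : IsLineFamily W) {n : ℕ} (hn : W.card = 2 * n) (i : Fin 10) :
    ∑ S ∈ W, ind S i = n := by
  have h := hW.sum_compl fun S => ind S i
  simp only [ind_compl, Finset.sum_sub_distrib, Finset.sum_const, hn, nsmul_eq_mul] at h
  push_cast at h
  linarith

theorem pairDegree_self (hW : IsLineFamily W) {n : ℕ} (hn : W.card = 2 * n) (i : Fin 10) :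
    pairDegree W i i = n := by
  simp only [pairDegree, ind_mul_self, hW.sum_ind_eq hn]

theorem sum_pairDegree_univ (hW : IsLineFamily W) {n : ℕ} (hn : W.card = 2 * n) (i : Fin 10) :
    ∑ j, pairDegree W i j = 5 * n := by
  rw [sum_pairDegree, ← hW.sum_ind_eq hn i, Finset.mul_sum]
  refine Finset.sum_congr rfl fun S hS => ?_
  rw [Finset.inter_univ, hW.card_eq S hS]
  push_cast
  ring

/-- Pair T with its complement: the two squares add up to 4 + 9 = 13, except for 25 + 0 when T is S
or its complement. -/
theorem sum_inter_sq (hW : IsLineFamily W) {n : ℕ} (hn : W.card = 2 * n) {S : Finset (Fin 10)}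
    (hS : S ∈ W) : ∑ T ∈ W, ((S ∩ T).card : ℤ) ^ 2 = 13 * n + 12 := by
  have h := hW.sum_compl fun T => ((S ∩ T).card : ℤ) ^ 2
  have hS5 := hW.card_eq S hS
  have h1 : ∀ T, ((S ∩ Tᶜ).card : ℤ) = 5 - (S ∩ T).card := by
    intro T
    rw [Finset.inter_comm, Finset.card_compl_inter_fin_ten, Finset.inter_comm T, hS5]
    rfl
  have h2 : ∀ T ∈ W, ((S ∩ T).card : ℤ) ^ 2 + ((S ∩ Tᶜ).card : ℤ) ^ 2 =
      13 + ((if T = S then 12 else 0) + (if T = Sᶜ then 12 else 0)) := by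
    intro T hT
    rw [h1]
    by_cases hTS : T = S
    · subst hTS
      simp [hS5]
    · by_cases hTS' : T = Sᶜ
      · subst hTS'
        simp [hTS]
      · rcases hW.inter S hS T hT hTS hTS' with h' | h' <;> simp [hTS, hTS', h']
  have h3 := Finset.sum_congr rfl h2
  rw [Finset.sum_add_distrib, h] at h3
  simp only [Finset.sum_add_distrib, Finset.sum_const, hn, Finset.sum_ite_eq', hS,
    hW.compl_mem S hS, if_true, nsmul_eq_mul] at h3
  push_cast at h3
  linarith

theorem sum_sum_pairDegree_sq_eq (hW : IsLineFamily W) {n : ℕ} (hn : W.card = 2 * n) :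
    ∑ i, ∑ j, pairDegree W i j ^ 2 = 2 * n * (13 * n + 12) := by
  rw [sum_sum_pairDegree_sq, Finset.sum_congr rfl fun S hS => hW.sum_inter_sq hn hS]
  simp [hn]

theorem sum_erase_quadratic (hW : IsLineFamily W) {n : ℕ} (hn : W.card = 2 * n) (a b c : ℤ) :
    ∑ i, ∑ j ∈ Finset.univ.erase i, (a * pairDegree W i j ^ 2 + b * pairDegree W i j + c) =
      a * (16 * n ^ 2 + 24 * n) + b * (40 * n) + 90 * c := by
  rw [Finset.sum_sum_erase]
  simp only [Finset.sum_add_distrib, ← Finset.mul_sum, hW.sum_sum_pairDegree_sq_eq hn,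
    hW.sum_pairDegree_univ hn, hW.pairDegree_self hn]
  simp
  ring

/-- The off-diagonal pair degrees have known sum 40n and known sum of squares 16n² + 24n, so
nonnegativity of suitable quadratics in them bounds n. -/
theorem card_le (hW : IsLineFamily W) {n : ℕ} (hn : W.card = 2 * n) : n ≤ 12 := by
  -- The mean off-diagonal degree is 4n/9, so this is the variance, scaled: it equals 1944n - 144n²,
  -- which is negative once n exceeds 13.
  have h1 := hW.sum_erase_quadratic hn 81 (-72 * n) (16 * n ^ 2)
  have h2 : 0 ≤ ∑ i, ∑ j ∈ Finset.univ.erase i,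
      (81 * pairDegree W i j ^ 2 + (-72 * n) * pairDegree W i j + 16 * (n : ℤ) ^ 2) :=
    Finset.sum_nonneg fun i _ => Finset.sum_nonneg fun j _ => by
      nlinarith [sq_nonneg (9 * pairDegree W i j - 4 * n)]
  rw [h1] at h2
  have h13 : n ≤ 13 := by
    by_contra h
    have h14 : (14 : ℤ) ≤ n := by exact_mod_cast not_le.1 h
    nlinarith
  -- Integrality excludes n = 13: (x - 5)(x - 6) is nonnegative on integers, yet its sum would be
  -- -4.
  have h3 := hW.sum_erase_quadratic hn 1 (-11) 30
  have h4 : 0 ≤ ∑ i, ∑ j ∈ Finset.univ.erase i,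
      (1 * pairDegree W i j ^ 2 + (-11) * pairDegree W i j + 30) :=
    Finset.sum_nonneg fun i _ => Finset.sum_nonneg fun j _ => by
      rcases le_or_gt (pairDegree W i j) 5 with h | h
      · nlinarith
      · have : 6 ≤ pairDegree W i j := h
        nlinarith
  rw [h3] at h4
  by_contra h
  have : n = 13 := by omega
  subst this
  norm_num at h4

/-- Complementation replaces the number t of members through i, j, k by inclusion-exclusion with -t,
so the three pair degrees sum to 2t + 12. -/
theorem even_pairDegree_add (hW : IsLineFamily W) (hc : W.card = 2 * 12) (i j k : Fin 10) :
    Even (pairDegree W i j + pairDegree W j k + pairDegree W i k) := by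
  have h := hW.sum_compl fun S => ind S i * ind S j * ind S k
  have h1 : ∀ S, ind Sᶜ i * ind Sᶜ j * ind Sᶜ k = 1 - ind S i - ind S j - ind S k +
      ind S i * ind S j + ind S j * ind S k + ind S i * ind S k - ind S i * ind S j * ind S k := by
    intro S
    simp only [ind_compl]
    ring
  simp only [h1, Finset.sum_sub_distrib, Finset.sum_add_distrib, hW.sum_ind_eq hc] at h
  simp only [Finset.sum_const, hc] at h
  refine ⟨∑ S ∈ W, ind S i * ind S j * ind S k + 6, ?_⟩
  simp only [pairDegree]
  simp at h
  linarith

/-- By the parity lemma, having even pair degree is an equivalence relation with at most two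
classes, A and its complement. Comparing second moments forces class sizes 4 and 6, and fixes the
degrees up to a choice of 4 or 6 inside the larger class. -/
theorem exists_tetrad (hW : IsLineFamily W) (hc : W.card = 2 * 12) :
    ∃ P : Finset (Fin 10), P.card = 4 ∧
      (∀ i ∈ P, ∀ j ∈ P, i ≠ j → pairDegree W i j = 6) ∧
      (∀ i ∈ P, ∀ j ∉ P, pairDegree W i j = 5) ∧
      (∀ i ∉ P, ∀ j ∉ P, i ≠ j → pairDegree W i j = 6 ∨ pairDegree W i j = 4) := by
  classical
  set A := Finset.univ.filter fun j => Even (pairDegree W 0 j) with hA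
  have hmem : ∀ i j, Even (pairDegree W i j) ↔ (i ∈ A ↔ j ∈ A) := by
    intro i j
    have h := hW.even_pairDegree_add hc 0 i j
    simp only [hA, Finset.mem_filter, Finset.mem_univ, true_and]
    simp only [Int.even_add] at h
    tauto
  have hodd : ∀ B : Finset (Fin 10), (∑ i, ∑ j, if (i ∈ B ↔ j ∈ B) then (0 : ℤ) else 1) =
      2 * B.card * (10 - B.card) := by
    intro B
    have h : ∀ i j, (if (i ∈ B ↔ j ∈ B) then (0 : ℤ) else 1) =
        ind B i * ind Bᶜ j + ind Bᶜ i * ind B j := by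
      intro i j
      by_cases hi : i ∈ B <;> by_cases hj : j ∈ B <;> simp [ind, hi, hj]
    have h2 : ∑ i, ind B i = B.card := by rw [sum_ind, Finset.inter_univ]
    simp only [h, Finset.sum_add_distrib, ← Finset.mul_sum, ← Finset.sum_mul, ind_compl,
      Finset.sum_sub_distrib, h2]
    simp
    ring
  -- The row of 0 sums to 60, so it has an even number of odd entries.
  have hev : Even A.card := by
    have h1 : Even (∑ j, (pairDegree W 0 j + ind Aᶜ j)) := by
      refine Finset.even_sum _ fun j _ => ?_
      have := hmem 0 j
      have h0 : (0 : Fin 10) ∈ A := by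
        simp only [hA, Finset.mem_filter, Finset.mem_univ, true_and, hW.pairDegree_self hc]
        decide
      by_cases hj : j ∈ A
      · simpa [ind, hj, h0] using this
      · simp [ind, hj, h0] at this ⊢
        exact this
    rw [Finset.sum_add_distrib, hW.sum_pairDegree_univ hc, sum_ind, Finset.card_compl_inter_fin_ten,
      Finset.inter_univ] at h1
    simp at h1
    have h2 : Even ((A.card : ℤ)) := by
      obtain ⟨x, hx⟩ := h1
      exact ⟨35 - x, by linarith⟩
    exact_mod_cast h2
  have hle : A.card ≤ 10 := by simpa using Finset.card_le_univ A
  -- (x - 4)(x - 6) is nonnegative for even x and at least -1 for odd x; the correction 1 for pairs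
  -- across the classes makes every term nonnegative.
  let h : Fin 10 → Fin 10 → ℤ := fun i j => (1 * pairDegree W i j ^ 2 + (-10) * pairDegree W i j + 24) +
    if (i ∈ A ↔ j ∈ A) then 0 else 1
  have hnonneg : ∀ i j, 0 ≤ h i j := by
    intro i j
    simp only [h]
    have h1 := hmem i j
    split_ifs with h2
    · obtain ⟨x, hx⟩ := h1.2 h2
      rcases le_or_gt x 2 with h3 | h3
      · nlinarith
      · have : 3 ≤ x := h3
        nlinarith
    · nlinarith [sq_nonneg (pairDegree W i j - 5)]
  have hsum : ∑ i, ∑ j ∈ Finset.univ.erase i, h i j = 2 * A.card * (10 - A.card) - 48 := by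
    simp only [h]
    simp only [Finset.sum_add_distrib (f := fun j => 1 * pairDegree W _ j ^ 2 + -10 * pairDegree W _ j + 24)]
    rw [Finset.sum_add_distrib, hW.sum_erase_quadratic hc,
      Finset.sum_sum_erase (f := fun i j => if (i ∈ A ↔ j ∈ A) then (0 : ℤ) else 1), hodd]
    simp
    ring
  have hsum_nonneg : 0 ≤ ∑ i, ∑ j ∈ Finset.univ.erase i, h i j :=
    Finset.sum_nonneg fun i _ => Finset.sum_nonneg fun j _ => hnonneg i j
  -- Nonnegativity reads a(10 - a) ≥ 24. For even a this leaves 4 and 6, both with equality, so all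
  -- terms of the sum vanish.
  have hA46 : A.card = 4 ∨ A.card = 6 := by
    rw [hsum] at hsum_nonneg
    clear * - hsum_nonneg hev hle
    generalize A.card = a at *
    interval_cases a <;> revert hev hsum_nonneg <;> decide
  have hzero : ∀ i j, i ≠ j → h i j = 0 := by
    intro i j hij
    have h0 : ∑ i, ∑ j ∈ Finset.univ.erase i, h i j = 0 := by
      rw [hsum]
      rcases hA46 with h | h <;> rw [h] <;> norm_num
    have h1 := (Finset.sum_eq_zero_iff_of_nonneg fun i _ =>
      Finset.sum_nonneg fun j _ => hnonneg i j).1 h0 i (Finset.mem_univ _)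
    exact (Finset.sum_eq_zero_iff_of_nonneg fun j _ => hnonneg i j).1 h1 j
      (Finset.mem_erase.2 ⟨hij.symm, Finset.mem_univ _⟩)
  have hsame : ∀ i j, i ≠ j → (i ∈ A ↔ j ∈ A) → pairDegree W i j = 6 ∨ pairDegree W i j = 4 := by
    intro i j hij h1
    have h2 := hzero i j hij
    simp only [h, h1, if_true] at h2
    have h3 : (pairDegree W i j - 6) * (pairDegree W i j - 4) = 0 := by linarith
    rcases mul_eq_zero.1 h3 with h4 | h4
    · left; linarith
    · right; linarith
  have hdiff : ∀ i j, ¬(i ∈ A ↔ j ∈ A) → pairDegree W i j = 5 := by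
    intro i j h1
    have hij : i ≠ j := by rintro rfl; exact h1 Iff.rfl
    have h2 := hzero i j hij
    simp only [h, h1, if_false] at h2
    have h3 : (pairDegree W i j - 5) ^ 2 = 0 := by linarith
    have := pow_eq_zero_iff (two_ne_zero) |>.1 h3
    linarith
  obtain ⟨P, hP4, hP⟩ : ∃ P : Finset (Fin 10), P.card = 4 ∧
      ∀ i j, (i ∈ P ↔ j ∈ P) ↔ (i ∈ A ↔ j ∈ A) := by
    rcases hA46 with h | h
    · exact ⟨A, h, fun i j => Iff.rfl⟩
    · refine ⟨Aᶜ, by rw [Finset.card_compl, h]; rfl, fun i j => ?_⟩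
      simp only [Finset.mem_compl, not_iff_not]
  have h1 : ∀ i ∈ P, ∀ j ∉ P, pairDegree W i j = 5 := fun i hi j hj =>
    hdiff i j (by rw [← hP]; exact fun h => hj (h.1 hi))
  refine ⟨P, hP4, fun i hi j hj hij => ?_, h1,
    fun i hi j hj hij => hsame i j hij ((hP i j).1 (iff_of_false hi hj))⟩
  have h60 := hW.sum_pairDegree_univ hc i
  rw [← Finset.sum_add_sum_compl P, Finset.sum_congr rfl fun j hj => h1 i hi j (Finset.mem_compl.1 hj),
    ← Finset.add_sum_erase P _ hi, hW.pairDegree_self hc] at h60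
  simp only [Finset.sum_const, Finset.card_compl, hP4] at h60
  simp at h60
  -- From the row sum 60, the diagonal takes 12 and the six points outside take 30; the remaining
  -- three entries are at most 6 and sum to 18.
  have h18 : ∑ x ∈ P.erase i, pairDegree W i x = ∑ x ∈ P.erase i, 6 := by
    rw [Finset.sum_const, Finset.card_erase_of_mem hi, hP4]
    simp
    linarith
  refine (Finset.sum_eq_sum_iff_of_le fun x hx => ?_).1 h18 j (Finset.mem_erase.2 ⟨hij.symm, hj⟩)
  obtain ⟨hx1, hx2⟩ := Finset.mem_erase.1 hx
  rcases hsame i x hx1.symm ((hP i x).1 (iff_of_true hi hx2)) with h | h <;> linarith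

end IsLineFamily

/-! ### The four-set attached to a family of twelve lines. -/

namespace IsLineFamily

variable {W : Finset (Finset (Fin 10))}

theorem sum_inter_card (hW : IsLineFamily W) (hc : W.card = 2 * 12) (P : Finset (Fin 10)) :
    ∑ S ∈ W, ((S ∩ P).card : ℤ) = 12 * P.card := by
  simp only [← sum_ind]
  rw [Finset.sum_comm]
  simp only [hW.sum_ind_eq hc, Finset.sum_const]
  simp
  ring

/-- All members of a family of twelve lines meet a suitable four-set in one or three points. -/
theorem exists_odd_tetrad (hW : IsLineFamily W) (hc : W.card = 2 * 12) :
    ∃ P : Finset (Fin 10), P.card = 4 ∧ ∀ S ∈ W, (S ∩ P).card = 1 ∨ (S ∩ P).card = 3 := by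
  obtain ⟨P, hP4, hPP, hPQ, -⟩ := hW.exists_tetrad hc
  refine ⟨P, hP4, ?_⟩
  have hle : ∀ S, (S ∩ P).card ≤ 4 := fun S => hP4 ▸ Finset.card_le_card Finset.inter_subset_right
  have hcompl : ∀ S, ((Sᶜ ∩ P).card : ℤ) = 4 - (S ∩ P).card := fun S => by
    rw [Finset.card_compl_inter_fin_ten, hP4]
    rfl
  have hrow : ∀ i ∈ P, ∑ j ∈ P, pairDegree W i j = 30 := by
    intro i hi
    rw [← Finset.add_sum_erase P _ hi, hW.pairDegree_self hc, Finset.sum_congr rfl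
      fun j hj => hPP i hi j (Finset.mem_of_mem_erase hj) (Finset.ne_of_mem_erase hj).symm,
      Finset.sum_const, Finset.card_erase_of_mem hi, hP4]
    norm_num
  have h120 : ∑ S ∈ W, ((S ∩ P).card : ℤ) ^ 2 = 120 := by
    rw [← sum_sum_pairDegree, Finset.sum_congr rfl hrow, Finset.sum_const, hP4]
    norm_num
  have h48 := hW.sum_inter_card hc P
  -- The mean square is 1 over the 24 members, so it suffices to exclude intersections of size 4
  -- and, by complementation, 0.
  have h24 : ∑ S ∈ W, (((S ∩ P).card : ℤ) - 2) ^ 2 = 24 := by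
    have h : ∀ S : Finset (Fin 10), (((S ∩ P).card : ℤ) - 2) ^ 2 =
      ((S ∩ P).card : ℤ) ^ 2 - 4 * ((S ∩ P).card : ℤ) + 4 := fun S => by ring
    simp only [h, Finset.sum_add_distrib, Finset.sum_sub_distrib, ← Finset.mul_sum, h120, h48,
      Finset.sum_const, hc, hP4]
    norm_num
  have hnot4 : ∀ S ∈ W, (S ∩ P).card ≠ 4 := by
    intro S hS h4
    have hPS : P ⊆ S := by
      have h : S ∩ P = P :=
        Finset.eq_of_subset_of_card_le Finset.inter_subset_right (by rw [h4, hP4])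
      exact Finset.inter_eq_right.1 h
    have hS5 := hW.card_eq S hS
    obtain ⟨q, hqS, hqP⟩ := Finset.exists_mem_notMem_of_card_lt_card (by rw [hP4, hS5]; norm_num :
      P.card < S.card)
    have hSeq : S = insert q P :=
      (Finset.eq_of_subset_of_card_le (Finset.insert_subset hqS hPS)
        (by rw [Finset.card_insert_of_notMem hqP, hP4, hS5])).symm
    have h20 : ∑ T ∈ W, ind T q * ((T ∩ P).card : ℤ) = 20 := by
      rw [← sum_pairDegree, Finset.sum_congr rfl fun j hj => by
        rw [pairDegree_comm, hPQ j hj q hqP], Finset.sum_const, hP4]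
      norm_num
    -- The square is invariant under complementation, and exactly one of T and its complement
    -- contains q, so this is half of 24.
    have h12 : ∑ T ∈ W, ind T q * (((T ∩ P).card : ℤ) - 2) ^ 2 = 12 := by
      have h1 := hW.sum_compl fun T => ind T q * (((T ∩ P).card : ℤ) - 2) ^ 2
      have h2 : ∀ T : Finset (Fin 10), ind Tᶜ q * (((Tᶜ ∩ P).card : ℤ) - 2) ^ 2 =
          (((T ∩ P).card : ℤ) - 2) ^ 2 - ind T q * (((T ∩ P).card : ℤ) - 2) ^ 2 := fun T => by
        rw [hcompl, ind_compl]
        ring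
      simp only [h2, Finset.sum_sub_distrib, h24] at h1
      linarith
    -- If T contains q and differs from S = P ∪ {q}, then |T ∩ P| is 1 or 2, where x² + x vanishes
    -- for x = |T ∩ P| - 2. Only T = S contributes, giving 6, whereas the known moments give 12 + 20
    -- - 24 = 8.
    have h6 : ∑ T ∈ W, ind T q * ((((T ∩ P).card : ℤ) - 2) ^ 2 + (((T ∩ P).card : ℤ) - 2)) =
        ∑ T ∈ W, if T = S then 6 else 0 := by
      refine Finset.sum_congr rfl fun T hT => ?_
      by_cases hqT : q ∈ T
      · by_cases hTS : T = S
        · subst hTS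
          simp [ind, hqT, h4]
        · have hTS' : T ≠ Sᶜ := by
            rintro rfl
            exact Finset.mem_compl.1 hqT hqS
          have hcard : (S ∩ T).card = (T ∩ P).card + 1 := by
            rw [hSeq, Finset.insert_inter_of_mem hqT, Finset.card_insert_of_notMem, Finset.inter_comm]
            exact fun h => hqP (Finset.mem_of_mem_inter_left h)
          have := hW.inter S hS T hT hTS hTS'
          have h : (T ∩ P).card = 1 ∨ (T ∩ P).card = 2 := by omega
          rcases h with h | h <;> simp [h, hTS]
      · have hTS : T ≠ S := by rintro rfl; exact hqT hqS
        simp [ind, hqT, hTS]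
    have h24' := hW.sum_ind_eq hc q
    have h : ∀ T : Finset (Fin 10),
        ind T q * ((((T ∩ P).card : ℤ) - 2) ^ 2 + (((T ∩ P).card : ℤ) - 2)) =
        ind T q * (((T ∩ P).card : ℤ) - 2) ^ 2 + ind T q * ((T ∩ P).card : ℤ) - 2 * ind T q :=
      fun T => by ring
    simp only [h, Finset.sum_add_distrib, Finset.sum_sub_distrib, ← Finset.mul_sum, h12, h20,
      h24', Finset.sum_ite_eq', hS, if_true] at h6
    norm_num at h6
  have hnot0 : ∀ S ∈ W, (S ∩ P).card ≠ 0 := by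
    intro S hS h0
    have := hcompl S
    refine hnot4 _ (hW.compl_mem S hS) ?_
    omega
  have hall : ∀ S ∈ W, (((S ∩ P).card : ℤ) - 2) ^ 2 = 1 := by
    refine (Finset.sum_eq_sum_iff_of_le fun S hS => ?_).1 ?_
    · have h1 := hle S
      have h2 := hnot4 S hS
      have h3 := hnot0 S hS
      generalize (S ∩ P).card = s at *
      interval_cases s <;> simp_all
    · rw [h24, Finset.sum_const, hc]
      norm_num
  intro S hS
  have h := hall S hS
  have h1 := hle S
  generalize (S ∩ P).card = s at *
  clear * - h h1
  revert h
  interval_cases s <;> simp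

/-- Intersections 1 and 3 make the degrees inside P sum to 120. This is the maximum, as off-diagonal
degrees are at most 6, so all pairs in P have degree 6. The degree pattern around the four-set B of
`exists_tetrad` then leaves only P = B. -/
theorem odd_tetrad_unique (hW : IsLineFamily W) (hc : W.card = 2 * 12) {P P' : Finset (Fin 10)}
    (hP4 : P.card = 4) (hP : ∀ S ∈ W, (S ∩ P).card = 1 ∨ (S ∩ P).card = 3)
    (hP4' : P'.card = 4) (hP' : ∀ S ∈ W, (S ∩ P').card = 1 ∨ (S ∩ P').card = 3) : P = P' := by
  obtain ⟨B, hB4, hBB, hBQ, hQQ⟩ := hW.exists_tetrad hc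
  suffices H : ∀ P : Finset (Fin 10), P.card = 4 →
      (∀ S ∈ W, (S ∩ P).card = 1 ∨ (S ∩ P).card = 3) → P = B from
    (H P hP4 hP).trans (H P' hP4' hP').symm
  clear hP hP' hP4 hP4'
  intro P hP4 hP
  have hle : ∀ i j, i ≠ j → pairDegree W i j ≤ 6 := by
    intro i j hij
    by_cases hi : i ∈ B <;> by_cases hj : j ∈ B
    · exact (hBB i hi j hj hij).le
    · rw [hBQ i hi j hj]; norm_num
    · rw [pairDegree_comm, hBQ j hj i hi]; norm_num
    · rcases hQQ i hi j hj hij with h | h <;> simp [h]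
  have hle' : ∀ i ∈ P, ∀ j ∈ P, pairDegree W i j ≤ if i = j then 12 else 6 := by
    intro i _ j _
    split_ifs with h
    · rw [h, hW.pairDegree_self hc]; norm_num
    · exact hle i j h
  have h120 : ∑ i ∈ P, ∑ j ∈ P, pairDegree W i j = 120 := by
    rw [sum_sum_pairDegree]
    have h48 := hW.sum_inter_card hc P
    have h : ∀ S ∈ W, ((S ∩ P).card : ℤ) ^ 2 = 4 * ((S ∩ P).card : ℤ) - 3 := by
      intro S hS
      rcases hP S hS with h | h <;> rw [h] <;> norm_num
    rw [Finset.sum_congr rfl h, Finset.sum_sub_distrib, ← Finset.mul_sum, h48, hP4,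
      Finset.sum_const, hc]
    norm_num
  have hrow : ∀ i ∈ P, ∑ j ∈ P, (if i = j then (12 : ℤ) else 6) = 30 := by
    intro i hi
    have : ∀ j, (if i = j then (12 : ℤ) else 6) = 6 + if i = j then 6 else 0 := fun j => by
      split_ifs <;> norm_num
    simp only [this, Finset.sum_add_distrib, Finset.sum_const, hP4, Finset.sum_ite_eq, hi, if_true]
    norm_num
  have hsix : ∀ i ∈ P, ∀ j ∈ P, i ≠ j → pairDegree W i j = 6 := by
    intro i hi j hj hij
    have h1 := (Finset.sum_eq_sum_iff_of_le fun i hi => Finset.sum_le_sum (hle' i hi)).1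
      (by rw [h120, Finset.sum_congr rfl hrow, Finset.sum_const, hP4]; norm_num) i hi
    have h2 := (Finset.sum_eq_sum_iff_of_le (hle' i hi)).1 h1 j hj
    rwa [if_neg hij] at h2
  by_cases hmeet : ∃ i ∈ P, i ∈ B
  · obtain ⟨i, hiP, hiB⟩ := hmeet
    refine Finset.eq_of_subset_of_card_le (fun j hj => ?_) (by rw [hP4, hB4])
    by_contra hjB
    have h1 := hBQ i hiB j hjB
    rw [hsix i hiP j hj (by rintro rfl; exact hjB hiB)] at h1
    norm_num at h1
  -- If P misses B, it lies in the six-point complement of B, where rows sum to 40. Counted from P,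
  -- the degrees to the two leftover points sum to 4 · 10 = 40; counted from those points, to at
  -- least 2 · 22.
  · exfalso
    have hPB : ∀ i ∈ P, i ∉ B := fun i hi hiB => hmeet ⟨i, hi, hiB⟩
    have hPBc : P ⊆ Bᶜ := fun i hi => Finset.mem_compl.2 (hPB i hi)
    have hcB : (Bᶜ).card = 6 := by rw [Finset.card_compl, hB4]; rfl
    have hcd : (Bᶜ \ P).card = 2 := by rw [Finset.card_sdiff_of_subset hPBc, hcB, hP4]
    have hrowQ : ∀ i ∉ B, ∑ j ∈ Bᶜ, pairDegree W i j = 40 := by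
      intro i hi
      have h := hW.sum_pairDegree_univ hc i
      rw [← Finset.sum_add_sum_compl B, Finset.sum_congr rfl fun j hj => by
        rw [pairDegree_comm, hBQ j hj i hi], Finset.sum_const, hB4] at h
      norm_num at h
      linarith
    have hrowP : ∀ i ∈ P, ∑ j ∈ P, pairDegree W i j = 30 := by
      intro i hi
      rw [← Finset.add_sum_erase P _ hi, hW.pairDegree_self hc, Finset.sum_congr rfl
        fun j hj => hsix i hi j (Finset.mem_of_mem_erase hj) (Finset.ne_of_mem_erase hj).symm,
        Finset.sum_const, Finset.card_erase_of_mem hi, hP4]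
      norm_num
    have h40 : ∑ i ∈ P, ∑ j ∈ Bᶜ \ P, pairDegree W i j = 40 := by
      have h : ∀ i ∈ P, ∑ j ∈ Bᶜ \ P, pairDegree W i j = 10 := by
        intro i hi
        have h1 := Finset.sum_sdiff (f := pairDegree W i) hPBc
        rw [hrowQ i (hPB i hi), hrowP i hi] at h1
        linarith
      rw [Finset.sum_congr rfl h, Finset.sum_const, hP4]
      norm_num
    rw [Finset.sum_comm] at h40
    have h22 : ∀ j ∈ Bᶜ \ P, 22 ≤ ∑ i ∈ P, pairDegree W i j := by
      intro j hj
      obtain ⟨hjB, hjP⟩ := Finset.mem_sdiff.1 hj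
      have hjB' := Finset.mem_compl.1 hjB
      have h1 := Finset.sum_sdiff (f := pairDegree W j) hPBc
      rw [hrowQ j hjB', ← Finset.add_sum_erase _ _ hj, hW.pairDegree_self hc] at h1
      have h2 : ∑ x ∈ (Bᶜ \ P).erase j, pairDegree W j x ≤ ∑ x ∈ (Bᶜ \ P).erase j, 6 :=
        Finset.sum_le_sum fun x hx => hle j x (Finset.ne_of_mem_erase hx).symm
      rw [Finset.sum_const, Finset.card_erase_of_mem hj, hcd] at h2
      simp only [pairDegree_comm W _ j]
      norm_num at h1 h2
      linarith
    have h44 := Finset.sum_le_sum h22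
    rw [h40, Finset.sum_const, hcd] at h44
    norm_num at h44

end IsLineFamily

/-! ### Perfect matchings of K₆ and the families over a fixed four-set. -/

/-- The fifteen perfect matchings of the complete graph on `{4, …, 9}`. -/
def matchingTable : Fin 15 → Finset (Finset (Fin 10)) :=
  ![{{4, 5}, {6, 7}, {8, 9}}, {{4, 5}, {6, 8}, {7, 9}}, {{4, 5}, {6, 9}, {7, 8}},
    {{4, 6}, {5, 7}, {8, 9}}, {{4, 6}, {5, 8}, {7, 9}}, {{4, 6}, {5, 9}, {7, 8}},
    {{4, 7}, {5, 6}, {8, 9}}, {{4, 7}, {5, 8}, {6, 9}}, {{4, 7}, {5, 9}, {6, 8}},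
    {{4, 8}, {5, 6}, {7, 9}}, {{4, 8}, {5, 7}, {6, 9}}, {{4, 8}, {5, 9}, {6, 7}},
    {{4, 9}, {5, 6}, {7, 8}}, {{4, 9}, {5, 7}, {6, 8}}, {{4, 9}, {5, 8}, {6, 7}}]

/-- Disjointness of the matchings in `matchingTable`, as a table of bit masks. -/
def matchingAdj (a b : Fin 15) : Bool :=
  Nat.testBit (![14256, 23784, 27480, 23430, 15685, 26307, 27702, 14891, 22045, 25005,
    20851, 12510, 3483, 2805, 1902] a) b

theorem disjoint_matchingTable_iff : ∀ a b,
    Disjoint (matchingTable a) (matchingTable b) ↔ matchingAdj a b = true := by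
  decide +kernel

theorem exists_matchingTable_eq :
    ∀ S ∈ ({4, 5, 6, 7, 8, 9} : Finset (Fin 10)).powersetCard 2,
    ∀ T ∈ ({4, 5, 6, 7, 8, 9} : Finset (Fin 10)).powersetCard 2, Disjoint S T →
    ∀ U ∈ ({4, 5, 6, 7, 8, 9} : Finset (Fin 10)).powersetCard 2, Disjoint S U → Disjoint T U →
    ∃ a, matchingTable a = {S, T, U} := by
  decide +kernel

theorem matchingTable_spec : ∀ a,
    matchingTable a ⊆ ({4, 5, 6, 7, 8, 9} : Finset (Fin 10)).powersetCard 2 ∧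
    (matchingTable a).card = 3 ∧
    ∀ S ∈ matchingTable a, ∀ T ∈ matchingTable a, S ≠ T → Disjoint S T := by
  decide +kernel

theorem matchingTable_injective : Function.Injective matchingTable := by
  decide +kernel

/-- There are `720` ordered quadruples of pairwise disjoint perfect matchings of `K₆`. -/
theorem card_disjoint_matchings :
    (Finset.univ.filter fun d : Fin 15 × Fin 15 × Fin 15 × Fin 15 =>
      matchingAdj d.1 d.2.1 ∧ (matchingAdj d.1 d.2.2.1 ∧ matchingAdj d.2.1 d.2.2.1) ∧
      (matchingAdj d.1 d.2.2.2 ∧ matchingAdj d.2.1 d.2.2.2 ∧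
        matchingAdj d.2.2.1 d.2.2.2)).card = 720 := by
  simp only [Finset.card_filter, Fintype.sum_prod_type, ite_and, Finset.sum_ite_irrel,
    Finset.sum_const_zero]
  decide +kernel

theorem matchingAdj_comm : ∀ a b, matchingAdj a b = matchingAdj b a := by
  decide +kernel

/-- For five-sets, complementing one of two sets changes the intersection from s to 5 - s, which
exchanges 2 and 3. No member has its complement in A, since these would be disjoint; hence the
doubling. -/
theorem isLineFamily_union_compl {A : Finset (Finset (Fin 10))} (h5 : ∀ S ∈ A, S.card = 5)
    (h : ∀ S ∈ A, ∀ T ∈ A, T ≠ S → (S ∩ T).card = 2 ∨ (S ∩ T).card = 3) :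
    IsLineFamily (A ∪ A.image compl) ∧ (A ∪ A.image compl).card = 2 * A.card := by
  have hmem : ∀ S, S ∈ A ∪ A.image compl ↔ S ∈ A ∨ Sᶜ ∈ A := by
    intro S
    simp only [Finset.mem_union, Finset.mem_image]
    refine or_congr_right ⟨?_, fun h => ⟨_, h, compl_compl S⟩⟩
    rintro ⟨T, hT, rfl⟩
    rwa [compl_compl]
  have hcc : ∀ S T : Finset (Fin 10), ((Sᶜ ∩ T).card : ℤ) = T.card - (S ∩ T).card :=
    Finset.card_compl_inter_fin_ten
  have hc5 : ∀ S, S ∈ A ∨ Sᶜ ∈ A → S.card = 5 := by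
    rintro S (hS | hS)
    · exact h5 S hS
    · have := h5 _ hS
      rw [Finset.card_compl, Fintype.card_fin] at this
      omega
  refine ⟨⟨fun S hS => hc5 S ((hmem S).1 hS), fun S hS => ?_, fun S hS T hT h1 h2 => ?_⟩, ?_⟩
  · rw [hmem] at hS ⊢
    rw [compl_compl]
    exact hS.symm
  · rw [hmem] at hS hT
    have hT5 := hc5 T hT
    have hS5 := hc5 S hS
    have e1 := hcc S T
    have e2 := hcc T S
    have e3 := hcc T Sᶜ
    rw [Finset.inter_comm T S] at e2
    rw [Finset.inter_comm T, Finset.inter_comm Tᶜ] at e3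
    rw [Finset.inter_comm Tᶜ] at e2
    rw [Finset.card_compl, hS5, Fintype.card_fin] at e3
    rcases hS with hS | hS <;> rcases hT with hT | hT
    · exact h S hS T hT h1
    · have := h S hS _ hT (fun e => h2 (by rw [← e, compl_compl]))
      omega
    · have := h _ hS T hT h2
      omega
    · have := h _ hS _ hT (fun e => h1 (compl_injective e))
      omega
  · rw [Finset.card_union_of_disjoint, Finset.card_image_of_injective _ compl_injective]
    · ring
    · rw [Finset.disjoint_left]
      intro S hS hS'
      obtain ⟨T, hT, rfl⟩ := Finset.mem_image.1 hS'
      have := h _ hS T hT IsLineFamily.ne_compl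
      rw [Finset.inter_comm, Finset.inter_compl] at this
      simp at this

/-- The four-set `{0, 1, 2, 3}`. -/
def tetrad : Finset (Fin 10) := {0, 1, 2, 3}

/-- The inclusion of `Fin 4` onto `tetrad`. -/
def tetradPoint (i : Fin 4) : Fin 10 := Fin.castLE (by norm_num) i

theorem mem_tetrad_iff : ∀ x, x ∈ tetrad ↔ ∃ i, tetradPoint i = x := by decide

theorem tetrad_compl : tetradᶜ = {4, 5, 6, 7, 8, 9} := by decide

theorem card_erase_tetrad : ∀ i, (tetrad.erase (tetradPoint i)).card = 3 := by decide

theorem card_erase_inter_erase : ∀ i j, i ≠ j →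
    (tetrad.erase (tetradPoint i) ∩ tetrad.erase (tetradPoint j)).card = 2 := by decide

theorem erase_tetrad_injective :
    Function.Injective fun i => tetrad.erase (tetradPoint i) := by decide

theorem card_inter_eq_add (S T P : Finset (Fin 10)) :
    (S ∩ T).card = ((S ∩ P) ∩ (T ∩ P)).card + ((S \ P) ∩ (T \ P)).card := by
  rw [← Finset.card_inter_add_card_sdiff (S ∩ T) P]
  congr 2 <;> ext x <;> simp only [Finset.mem_inter, Finset.mem_sdiff] <;> tauto

theorem eq_of_inter_eq_of_sdiff_eq {S T P : Finset (Fin 10)} (h1 : S ∩ P = T ∩ P)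
    (h2 : S \ P = T \ P) : S = T := by
  rw [← Finset.sdiff_union_inter S P, ← Finset.sdiff_union_inter T P, h1, h2]

/-- The twelve sets meeting `tetrad` in three points that are prescribed by four matchings. -/
def halfFamily (d : Fin 4 → Fin 15) : Finset (Finset (Fin 10)) :=
  Finset.univ.biUnion fun i => (matchingTable (d i)).image fun T =>
    tetrad.erase (tetradPoint i) ∪ T

theorem subset_compl_of_mem_matchingTable {a : Fin 15} {T : Finset (Fin 10)}
    (hT : T ∈ matchingTable a) : T ⊆ tetradᶜ ∧ T.card = 2 := by
  rw [tetrad_compl]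
  exact Finset.mem_powersetCard.1 ((matchingTable_spec a).1 hT)

theorem erase_union_inter {T : Finset (Fin 10)} (hT : T ⊆ tetradᶜ) (i : Fin 10) :
    (tetrad.erase i ∪ T) ∩ tetrad = tetrad.erase i ∧ (tetrad.erase i ∪ T) \ tetrad = T := by
  have h : ∀ x, x ∈ T → x ∉ tetrad := fun x hx => Finset.mem_compl.1 (hT hx)
  constructor <;> ext x <;> have := h x <;>
    simp only [Finset.mem_inter, Finset.mem_sdiff, Finset.mem_union, Finset.mem_erase] <;> tauto

theorem mem_halfFamily {d : Fin 4 → Fin 15} {S : Finset (Fin 10)} :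
    S ∈ halfFamily d ↔ ∃ i, S ∩ tetrad = tetrad.erase (tetradPoint i) ∧
      S \ tetrad ∈ matchingTable (d i) := by
  simp only [halfFamily, Finset.mem_biUnion, Finset.mem_univ, true_and, Finset.mem_image]
  refine exists_congr fun i => ⟨?_, fun h => ⟨_, h.2, ?_⟩⟩
  · rintro ⟨T, hT, rfl⟩
    obtain ⟨h1, h2⟩ := erase_union_inter (subset_compl_of_mem_matchingTable hT).1 (tetradPoint i)
    exact ⟨h1, h2.symm ▸ hT⟩
  · rw [← h.1, Finset.union_comm, Finset.sdiff_union_inter]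

theorem card_inter_tetrad_of_mem_halfFamily {d : Fin 4 → Fin 15} {S : Finset (Fin 10)}
    (hS : S ∈ halfFamily d) : (S ∩ tetrad).card = 3 := by
  obtain ⟨i, hi, -⟩ := mem_halfFamily.1 hS
  rw [hi, card_erase_tetrad]

theorem card_of_mem_halfFamily {d : Fin 4 → Fin 15} {S : Finset (Fin 10)}
    (hS : S ∈ halfFamily d) : S.card = 5 := by
  obtain ⟨i, hi, hi'⟩ := mem_halfFamily.1 hS
  rw [← Finset.card_inter_add_card_sdiff S tetrad, hi, card_erase_tetrad,
    (subset_compl_of_mem_matchingTable hi').2]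

theorem card_halfFamily (d : Fin 4 → Fin 15) : (halfFamily d).card = 12 := by
  rw [halfFamily, Finset.card_biUnion]
  · rw [Finset.sum_congr rfl fun i _ => Finset.card_image_of_injOn ?_]
    · simp [(matchingTable_spec _).2.1]
    · intro T hT T' hT' h
      have h1 := erase_union_inter (subset_compl_of_mem_matchingTable hT).1 (tetradPoint i)
      have h2 := erase_union_inter (subset_compl_of_mem_matchingTable hT').1 (tetradPoint i)
      rw [← h1.2, ← h2.2]
      exact congrArg (· \ tetrad) h
  · intro i _ j _ hij
    rw [Function.onFun, Finset.disjoint_left]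
    intro S hS hS'
    obtain ⟨T, hT, rfl⟩ := Finset.mem_image.1 hS
    obtain ⟨T', hT', h⟩ := Finset.mem_image.1 hS'
    have h1 := erase_union_inter (subset_compl_of_mem_matchingTable hT).1 (tetradPoint i)
    have h2 := erase_union_inter (subset_compl_of_mem_matchingTable hT').1 (tetradPoint j)
    apply hij
    apply erase_tetrad_injective
    simp only
    rw [← h1.1, ← h2.1, h]

/-- Equal traces on `tetrad` contribute 3 and the outer pairs are disjoint. Different traces
contribute 2 and the outer pairs, coming from disjoint matchings, are distinct, so they share at
most one point. -/
theorem halfFamily_inter {d : Fin 4 → Fin 15} (hd : ∀ i j, i ≠ j → matchingAdj (d i) (d j) = true)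
    {S T : Finset (Fin 10)} (hS : S ∈ halfFamily d) (hT : T ∈ halfFamily d) (hne : T ≠ S) :
    (S ∩ T).card = 2 ∨ (S ∩ T).card = 3 := by
  obtain ⟨i, hi, hi'⟩ := mem_halfFamily.1 hS
  obtain ⟨j, hj, hj'⟩ := mem_halfFamily.1 hT
  rw [card_inter_eq_add S T tetrad]
  by_cases hij : i = j
  · subst hij
    right
    have hne' : S \ tetrad ≠ T \ tetrad := fun h =>
      hne (eq_of_inter_eq_of_sdiff_eq (hj.trans hi.symm) h.symm)
    have := Finset.disjoint_iff_inter_eq_empty.1 ((matchingTable_spec _).2.2 _ hi' _ hj' hne')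
    rw [this, hi, hj, Finset.inter_self, card_erase_tetrad]
    rfl
  · rw [hi, hj, card_erase_inter_erase i j hij]
    have hdisj := (disjoint_matchingTable_iff _ _).2 (hd i j hij)
    have hne' : S \ tetrad ≠ T \ tetrad := fun h =>
      Finset.disjoint_left.1 hdisj hi' (h ▸ hj')
    have hlt : ((S \ tetrad) ∩ (T \ tetrad)).card < 2 := by
      have h2 := (subset_compl_of_mem_matchingTable hi').2
      have h2' := (subset_compl_of_mem_matchingTable hj').2
      refine lt_of_le_of_ne (h2 ▸ Finset.card_le_card Finset.inter_subset_left) fun h => hne' ?_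
      have e1 := Finset.eq_of_subset_of_card_le
        (Finset.inter_subset_left (s₁ := S \ tetrad) (s₂ := T \ tetrad)) (by rw [h, h2])
      have e2 := Finset.eq_of_subset_of_card_le
        (Finset.inter_subset_right (s₁ := S \ tetrad) (s₂ := T \ tetrad)) (by rw [h, h2'])
      exact e1.symm.trans e2
    omega

namespace IsLineFamily

variable {W : Finset (Finset (Fin 10))}

theorem card_filter_three (hW : IsLineFamily W) (hc : W.card = 2 * 12)
    (hP : ∀ S ∈ W, (S ∩ tetrad).card = 1 ∨ (S ∩ tetrad).card = 3) :
    (W.filter fun S => (S ∩ tetrad).card = 3).card = 12 := by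
  have h48 := hW.sum_inter_card hc tetrad
  have h : ∀ S ∈ W, ((S ∩ tetrad).card : ℤ) = 1 + 2 * if (S ∩ tetrad).card = 3 then 1 else 0 := by
    intro S hS
    rcases hP S hS with h | h <;> simp [h]
  rw [Finset.sum_congr rfl h, Finset.sum_add_distrib, ← Finset.mul_sum, Finset.sum_boole] at h48
  simp [hc, tetrad] at h48
  simp only [tetrad]
  omega

theorem disjoint_sdiff_tetrad (hW : IsLineFamily W) {i : Fin 4} {S T : Finset (Fin 10)}
    (hS : S ∈ W) (hT : T ∈ W) (hSi : S ∩ tetrad = tetrad.erase (tetradPoint i))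
    (hTi : T ∩ tetrad = tetrad.erase (tetradPoint i)) (hne : T ≠ S) :
    Disjoint (S \ tetrad) (T \ tetrad) := by
  have h := card_inter_eq_add S T tetrad
  rw [hSi, hTi, Finset.inter_self, card_erase_tetrad] at h
  have hne' : T ≠ Sᶜ := by
    rintro rfl
    rw [Finset.inter_compl] at h
    simp at h
    omega
  have := hW.inter S hS T hT hne hne'
  rw [Finset.disjoint_iff_inter_eq_empty, ← Finset.card_eq_zero]
  omega

theorem sdiff_tetrad_mem (hW : IsLineFamily W) {i : Fin 4} {S : Finset (Fin 10)}
    (hS : S ∈ W) (hSi : S ∩ tetrad = tetrad.erase (tetradPoint i)) :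
    S \ tetrad ∈ ({4, 5, 6, 7, 8, 9} : Finset (Fin 10)).powersetCard 2 := by
  rw [← tetrad_compl, Finset.mem_powersetCard]
  refine ⟨fun x hx => Finset.mem_compl.2 (Finset.mem_sdiff.1 hx).2, ?_⟩
  have := Finset.card_inter_add_card_sdiff S tetrad
  rw [hSi, card_erase_tetrad, hW.card_eq S hS] at this
  omega

/-- The outer pairs of members with the same trace are disjoint in six points, so there are at most
three. The four traces share twelve members, so equality holds for each. -/
theorem card_filter_erase (hW : IsLineFamily W) (hc : W.card = 2 * 12)
    (hP : ∀ S ∈ W, (S ∩ tetrad).card = 1 ∨ (S ∩ tetrad).card = 3) (i : Fin 4) :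
    (W.filter fun S => S ∩ tetrad = tetrad.erase (tetradPoint i)).card = 3 := by
  have hle : ∀ i, (W.filter fun S => S ∩ tetrad = tetrad.erase (tetradPoint i)).card ≤ 3 := by
    intro i
    set V := W.filter fun S => S ∩ tetrad = tetrad.erase (tetradPoint i)
    have h : (V.biUnion fun S => S \ tetrad).card = ∑ S ∈ V, (S \ tetrad).card := by
      refine Finset.card_biUnion fun S hS T hT hne => ?_
      obtain ⟨hS1, hS2⟩ := Finset.mem_filter.1 hS
      obtain ⟨hT1, hT2⟩ := Finset.mem_filter.1 hT
      exact hW.disjoint_sdiff_tetrad hS1 hT1 hS2 hT2 hne.symm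
    have h2 : ∀ S ∈ V, (S \ tetrad).card = 2 := fun S hS =>
      (Finset.mem_powersetCard.1 (hW.sdiff_tetrad_mem (Finset.mem_filter.1 hS).1
        (Finset.mem_filter.1 hS).2)).2
    have h6 : (V.biUnion fun S => S \ tetrad).card ≤ (tetradᶜ).card :=
      Finset.card_le_card fun x hx => by
        obtain ⟨S, -, hx⟩ := Finset.mem_biUnion.1 hx
        exact Finset.mem_compl.2 (Finset.mem_sdiff.1 hx).2
    rw [h, Finset.sum_congr rfl h2, Finset.sum_const, tetrad_compl] at h6
    simp at h6
    omega
  have h12 : ∑ i, (W.filter fun S => S ∩ tetrad = tetrad.erase (tetradPoint i)).card = 12 := by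
    rw [← hW.card_filter_three hc hP, ← Finset.card_biUnion]
    · congr 1
      ext S
      simp only [Finset.mem_biUnion, Finset.mem_univ, true_and, Finset.mem_filter]
      constructor
      · rintro ⟨i, hS, hi⟩
        exact ⟨hS, by rw [hi, card_erase_tetrad]⟩
      · rintro ⟨hS, h3⟩
        obtain ⟨x, hx, hxS⟩ := Finset.exists_mem_notMem_of_card_lt_card
          (by rw [h3]; decide : (S ∩ tetrad).card < tetrad.card)
        obtain ⟨j, rfl⟩ := (mem_tetrad_iff x).1 hx
        refine ⟨j, hS, Finset.eq_of_subset_of_card_le (fun y hy => ?_) ?_⟩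
        · exact Finset.mem_erase.2 ⟨fun e => hxS (e ▸ hy), Finset.mem_of_mem_inter_right hy⟩
        · rw [h3, card_erase_tetrad]
    · intro i _ j _ hij
      rw [Function.onFun, Finset.disjoint_left]
      intro S hS hS'
      exact hij (erase_tetrad_injective
        ((Finset.mem_filter.1 hS).2.symm.trans (Finset.mem_filter.1 hS').2))
  exact (Finset.sum_eq_sum_iff_of_le (g := fun _ => 3) fun i _ => hle i).1
    (by rw [h12]; simp) i (Finset.mem_univ i)

/-- The three outer pairs over each trace partition the six outer points, hence form a perfect
matching. A pair common to two of the matchings would give an intersection of size 2 + 2 = 4. -/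
theorem exists_halfFamily (hW : IsLineFamily W) (hc : W.card = 2 * 12)
    (hP : ∀ S ∈ W, (S ∩ tetrad).card = 1 ∨ (S ∩ tetrad).card = 3) :
    ∃ d : Fin 4 → Fin 15, (∀ i j, i ≠ j → matchingAdj (d i) (d j) = true) ∧
      W = halfFamily d ∪ (halfFamily d).image compl := by
  have hm : ∀ i : Fin 4, ∃ a, matchingTable a =
      (W.filter fun S => S ∩ tetrad = tetrad.erase (tetradPoint i)).image (· \ tetrad) := by
    intro i
    obtain ⟨S, T, U, hST, hSU, hTU, hV⟩ := Finset.card_eq_three.1 (hW.card_filter_erase hc hP i)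
    have hS := Finset.mem_filter.1 (hV ▸ (by simp) :
      S ∈ W.filter fun S => S ∩ tetrad = tetrad.erase (tetradPoint i))
    have hT := Finset.mem_filter.1 (hV ▸ (by simp) :
      T ∈ W.filter fun S => S ∩ tetrad = tetrad.erase (tetradPoint i))
    have hU := Finset.mem_filter.1 (hV ▸ (by simp) :
      U ∈ W.filter fun S => S ∩ tetrad = tetrad.erase (tetradPoint i))
    obtain ⟨a, ha⟩ := exists_matchingTable_eq _ (hW.sdiff_tetrad_mem hS.1 hS.2)
      _ (hW.sdiff_tetrad_mem hT.1 hT.2) (hW.disjoint_sdiff_tetrad hS.1 hT.1 hS.2 hT.2 hST.symm)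
      _ (hW.sdiff_tetrad_mem hU.1 hU.2) (hW.disjoint_sdiff_tetrad hS.1 hU.1 hS.2 hU.2 hSU.symm)
      (hW.disjoint_sdiff_tetrad hT.1 hU.1 hT.2 hU.2 hTU.symm)
    refine ⟨a, ?_⟩
    rw [ha, hV]
    simp [Finset.image_insert]
  choose d hd using hm
  have hsub : halfFamily d ⊆ W := by
    intro S hS
    obtain ⟨i, hi, hi'⟩ := mem_halfFamily.1 hS
    rw [hd] at hi'
    obtain ⟨T, hT, hTS⟩ := Finset.mem_image.1 hi'
    obtain ⟨hT1, hT2⟩ := Finset.mem_filter.1 hT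
    rwa [← eq_of_inter_eq_of_sdiff_eq (hT2.trans hi.symm) hTS]
  have hadj : ∀ i j, i ≠ j → matchingAdj (d i) (d j) = true := by
    intro i j hij
    rw [← disjoint_matchingTable_iff, Finset.disjoint_left]
    intro T hT hT'
    rw [hd] at hT hT'
    obtain ⟨S, hS, rfl⟩ := Finset.mem_image.1 hT
    obtain ⟨S', hS', h⟩ := Finset.mem_image.1 hT'
    obtain ⟨hS1, hS2⟩ := Finset.mem_filter.1 hS
    obtain ⟨hS'1, hS'2⟩ := Finset.mem_filter.1 hS'
    have hcard := card_inter_eq_add S S' tetrad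
    rw [hS2, hS'2, card_erase_inter_erase i j hij, h, Finset.inter_self,
      (Finset.mem_powersetCard.1 (hW.sdiff_tetrad_mem hS1 hS2)).2] at hcard
    have hne : S' ≠ S := by
      rintro rfl
      exact hij (erase_tetrad_injective (hS2.symm.trans hS'2))
    have hne' : S' ≠ Sᶜ := by
      rintro rfl
      rw [Finset.inter_compl] at hcard
      simp at hcard
    have := hW.inter S hS1 S' hS'1 hne hne'
    omega
  refine ⟨d, hadj, ?_⟩
  have h24 := (isLineFamily_union_compl (fun S hS => card_of_mem_halfFamily hS)
    (fun S hS T hT hne => halfFamily_inter hadj hS hT hne)).2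
  refine (Finset.eq_of_subset_of_card_le (Finset.union_subset hsub ?_) ?_).symm
  · intro S hS
    obtain ⟨T, hT, rfl⟩ := Finset.mem_image.1 hS
    exact hW.compl_mem T (hsub hT)
  · rw [h24, hc, card_halfFamily]

end IsLineFamily

theorem filter_three_halfFamily (d : Fin 4 → Fin 15) :
    (halfFamily d ∪ (halfFamily d).image compl).filter (fun S => (S ∩ tetrad).card = 3) =
      halfFamily d := by
  ext S
  simp only [Finset.mem_filter, Finset.mem_union, Finset.mem_image]
  constructor
  · rintro ⟨h | ⟨T, hT, rfl⟩, h3⟩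
    · exact h
    · have := Finset.card_compl_inter_fin_ten T tetrad
      rw [h3, card_inter_tetrad_of_mem_halfFamily hT] at this
      simp [tetrad] at this
  · exact fun h => ⟨Or.inl h, card_inter_tetrad_of_mem_halfFamily h⟩

theorem halfFamily_injective : Function.Injective halfFamily := by
  intro d d' h
  have hsub : ∀ i, matchingTable (d i) ⊆ matchingTable (d' i) := by
    intro i T hT
    have h1 := erase_union_inter (subset_compl_of_mem_matchingTable hT).1 (tetradPoint i)
    have h2 : tetrad.erase (tetradPoint i) ∪ T ∈ halfFamily d :=
      mem_halfFamily.2 ⟨i, h1.1, h1.2.symm ▸ hT⟩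
    rw [h, mem_halfFamily] at h2
    obtain ⟨j, hj, hj'⟩ := h2
    rw [h1.1] at hj
    rw [h1.2] at hj'
    rwa [erase_tetrad_injective hj]
  funext i
  exact matchingTable_injective (Finset.eq_of_subset_of_card_le (hsub i)
    (by rw [(matchingTable_spec _).2.1, (matchingTable_spec _).2.1]))

/-! ### Counting the families of twelve lines. -/

open Classical in
/-- The families of twelve lines all of whose members meet `P` in one or three points. -/
noncomputable def lineFamiliesOver (P : Finset (Fin 10)) : Finset (Finset (Finset (Fin 10))) :=
  Finset.univ.filter fun W => (IsLineFamily W ∧ W.card = 2 * 12) ∧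
    ∀ S ∈ W, (S ∩ P).card = 1 ∨ (S ∩ P).card = 3

theorem mem_lineFamiliesOver {P : Finset (Fin 10)} {W : Finset (Finset (Fin 10))} :
    W ∈ lineFamiliesOver P ↔ (IsLineFamily W ∧ W.card = 2 * 12) ∧
      ∀ S ∈ W, (S ∩ P).card = 1 ∨ (S ∩ P).card = 3 := by
  simp [lineFamiliesOver]

/-- The four matchings are recovered from the family: its members meeting `tetrad` in three points
form `halfFamily`. -/
theorem card_lineFamiliesOver_tetrad : (lineFamiliesOver tetrad).card = 720 := by
  rw [← card_disjoint_matchings]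
  symm
  have hquad : ∀ p : Fin 15 × Fin 15 × Fin 15 × Fin 15,
      (matchingAdj p.1 p.2.1 ∧ (matchingAdj p.1 p.2.2.1 ∧ matchingAdj p.2.1 p.2.2.1) ∧
      (matchingAdj p.1 p.2.2.2 ∧ matchingAdj p.2.1 p.2.2.2 ∧ matchingAdj p.2.2.1 p.2.2.2)) →
      ∀ i j, i ≠ j →
        matchingAdj (![p.1, p.2.1, p.2.2.1, p.2.2.2] i) (![p.1, p.2.1, p.2.2.1, p.2.2.2] j) = true := by
    rintro ⟨a, b, c, e⟩ ⟨h1, ⟨h2, h3⟩, h4, h5, h6⟩ i j hij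
    fin_cases i <;> fin_cases j <;> first
      | exact absurd rfl hij
      | assumption
      | (rw [matchingAdj_comm]; assumption)
  refine Finset.card_bij (fun p _ => halfFamily ![p.1, p.2.1, p.2.2.1, p.2.2.2] ∪
    (halfFamily ![p.1, p.2.1, p.2.2.1, p.2.2.2]).image compl) ?_ ?_ ?_
  · intro p hp
    have hp' := hquad p (Finset.mem_filter.1 hp).2
    set d := ![p.1, p.2.1, p.2.2.1, p.2.2.2]
    have h := isLineFamily_union_compl (fun S hS => card_of_mem_halfFamily hS)
      (fun S hS T hT hne => halfFamily_inter hp' hS hT hne)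
    refine mem_lineFamiliesOver.2 ⟨⟨h.1, by rw [h.2, card_halfFamily]⟩, ?_⟩
    intro S hS
    rcases Finset.mem_union.1 hS with hS | hS
    · exact Or.inr (card_inter_tetrad_of_mem_halfFamily hS)
    · obtain ⟨T, hT, rfl⟩ := Finset.mem_image.1 hS
      left
      have := Finset.card_compl_inter_fin_ten T tetrad
      rw [card_inter_tetrad_of_mem_halfFamily hT] at this
      have h4 : tetrad.card = 4 := by decide
      omega
  · intro p _ q _ h
    have h1 := congrArg (Finset.filter fun S => (S ∩ tetrad).card = 3) h
    simp only [filter_three_halfFamily] at h1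
    have h2 := halfFamily_injective h1
    have e0 := congrFun h2 0
    have e1 := congrFun h2 1
    have e2 := congrFun h2 2
    have e3 := congrFun h2 3
    simp at e0 e1 e2 e3
    ext1
    · exact e0
    · ext1
      · exact e1
      · ext1
        · exact e2
        · exact e3
  · intro W hW
    obtain ⟨⟨hW1, hW2⟩, hW3⟩ := mem_lineFamiliesOver.1 hW
    obtain ⟨d, hd, rfl⟩ := hW1.exists_halfFamily hW2 hW3
    refine ⟨(d 0, d 1, d 2, d 3), Finset.mem_filter.2 ⟨Finset.mem_univ _, ?_⟩, ?_⟩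
    · exact ⟨hd 0 1 (by decide), ⟨hd 0 2 (by decide), hd 1 2 (by decide)⟩, hd 0 3 (by decide),
        hd 1 3 (by decide), hd 2 3 (by decide)⟩
    · have : ![d 0, d 1, d 2, d 3] = d := by
        funext i
        fin_cases i <;> rfl
      simp only [this]

theorem map_mem_lineFamiliesOver (σ : Equiv.Perm (Fin 10)) {P : Finset (Fin 10)}
    {W : Finset (Finset (Fin 10))} (hW : W ∈ lineFamiliesOver P) :
    W.map (Finset.mapEmbedding σ.toEmbedding).toEmbedding ∈
      lineFamiliesOver (P.map σ.toEmbedding) := by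
  have hcompl : ∀ S : Finset (Fin 10), (S.map σ.toEmbedding)ᶜ = Sᶜ.map σ.toEmbedding := by
    intro S
    ext x
    simp
  obtain ⟨⟨hW1, hW2⟩, hW3⟩ := mem_lineFamiliesOver.1 hW
  refine mem_lineFamiliesOver.2 ⟨⟨⟨?_, ?_, ?_⟩, ?_⟩, ?_⟩
  · intro S hS
    obtain ⟨S, hS', rfl⟩ := Finset.mem_map.1 hS
    simpa using hW1.card_eq S hS'
  · intro S hS
    obtain ⟨S, hS', rfl⟩ := Finset.mem_map.1 hS
    refine Finset.mem_map.2 ⟨Sᶜ, hW1.compl_mem S hS', ?_⟩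
    exact (hcompl S).symm
  · intro S hS T hT h1 h2
    obtain ⟨S, hS', rfl⟩ := Finset.mem_map.1 hS
    obtain ⟨T, hT', rfl⟩ := Finset.mem_map.1 hT
    have := hW1.inter S hS' T hT' (fun e => h1 (by rw [e])) (fun e => h2 (by
      rw [e]
      exact (hcompl S).symm))
    simpa [← Finset.map_inter] using this
  · rw [Finset.card_map, hW2]
  · intro S hS
    obtain ⟨S, hS', rfl⟩ := Finset.mem_map.1 hS
    have := hW3 S hS'
    simpa [← Finset.map_inter] using this

theorem card_lineFamiliesOver {P : Finset (Fin 10)} (hP : P.card = 4) :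
    (lineFamiliesOver P).card = 720 := by
  have hle : ∀ (σ : Equiv.Perm (Fin 10)) (P : Finset (Fin 10)),
      (lineFamiliesOver P).card ≤ (lineFamiliesOver (P.map σ.toEmbedding)).card := fun σ P =>
    Finset.card_le_card_of_injOn _ (fun W hW => map_mem_lineFamiliesOver σ hW)
      (Finset.map_injective _).injOn
  have e : {x // x ∈ tetrad} ≃ {x // x ∈ P} :=
    Finset.equivOfCardEq (by rw [hP]; decide)
  have he : tetrad.map e.extendSubtype.toEmbedding = P := by
    refine Finset.eq_of_subset_of_card_le (fun x hx => ?_) (by rw [Finset.card_map, hP]; decide)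
    obtain ⟨y, hy, rfl⟩ := Finset.mem_map.1 hx
    exact e.extendSubtype_mem y hy
  generalize e.extendSubtype = σ at he
  have h1 := hle σ tetrad
  have h2 := hle σ⁻¹ P
  have he' : P.map (σ⁻¹ : Equiv.Perm (Fin 10)).toEmbedding = tetrad := by
    rw [← he, Finset.map_map]
    ext x
    simp
  rw [he, card_lineFamiliesOver_tetrad] at h1
  rw [he', card_lineFamiliesOver_tetrad] at h2
  omega

open Classical in
/-- The families of twelve lines. -/
noncomputable def lineFamilies : Finset (Finset (Finset (Fin 10))) :=
  Finset.univ.filter fun W => IsLineFamily W ∧ W.card = 2 * 12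

theorem mem_lineFamilies {W : Finset (Finset (Fin 10))} :
    W ∈ lineFamilies ↔ IsLineFamily W ∧ W.card = 2 * 12 := by
  simp [lineFamilies]

/-- Existence and uniqueness of the four-set partition the families into C(10,4) = 210 classes of
size 720. -/
theorem card_lineFamilies : lineFamilies.card = 151200 := by
  classical
  have h : lineFamilies =
      ((Finset.univ : Finset (Fin 10)).powersetCard 4).biUnion lineFamiliesOver := by
    ext W
    simp only [mem_lineFamilies, Finset.mem_biUnion, Finset.mem_powersetCard, mem_lineFamiliesOver,
      Finset.subset_univ, true_and]
    constructor
    · rintro ⟨h1, h2⟩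
      obtain ⟨P, hP, hP'⟩ := h1.exists_odd_tetrad h2
      exact ⟨P, hP, ⟨h1, h2⟩, hP'⟩
    · rintro ⟨P, -, h, -⟩
      exact h
  rw [h, Finset.card_biUnion]
  · rw [Finset.sum_congr rfl fun P hP => card_lineFamiliesOver (Finset.mem_powersetCard.1 hP).2,
      Finset.sum_const, Finset.card_powersetCard]
    decide
  · intro P hP P' hP' hne
    rw [Function.onFun, Finset.disjoint_left]
    intro W hW hW'
    obtain ⟨⟨hW1, hW2⟩, hW3⟩ := mem_lineFamiliesOver.1 hW
    obtain ⟨-, hW4⟩ := mem_lineFamiliesOver.1 hW'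
    exact hne (hW1.odd_tetrad_unique hW2 (Finset.mem_powersetCard.1 hP).2 hW3
      (Finset.mem_powersetCard.1 hP').2 hW4)

/-! ### Coordinates for the cosets of L. -/

theorem inner_triple (x y x' y' : Fin 10 → ℝ) (z z' : Fin 2 → ℝ) :
    ⟪triple x y z, triple x' y' z'⟫ = ∑ j, x j * x' j + ∑ j, y j * y' j + ∑ j, z j * z' j := by
  simp only [triple, PiLp.inner_apply, Fintype.sum_sum_type, Sum.elim_inl, Sum.elim_inr,
    RCLike.inner_apply, conj_trivial]
  simp only [mul_comm, add_assoc]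

theorem triple_eta (γ : Space) : γ = triple (fun j => γ (Sum.inl j))
    (fun j => γ (Sum.inr (Sum.inl j))) (fun j => γ (Sum.inr (Sum.inr j))) := by
  ext (j | j | j) <;> rfl

theorem triple_inj {x y x' y' : Fin 10 → ℝ} {z z' : Fin 2 → ℝ} :
    triple x y z = triple x' y' z' ↔ x = x' ∧ y = y' ∧ z = z' := by
  constructor
  · intro h
    refine ⟨?_, ?_, ?_⟩ <;> funext j
    · exact congrArg (fun γ : Space => γ (Sum.inl j)) h
    · exact congrArg (fun γ : Space => γ (Sum.inr (Sum.inl j))) h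
    · exact congrArg (fun γ : Space => γ (Sum.inr (Sum.inr j))) h
  · rintro ⟨rfl, rfl, rfl⟩
    rfl

theorem triple_sub (x y x' y' : Fin 10 → ℝ) (z z' : Fin 2 → ℝ) :
    triple x y z - triple x' y' z' = triple (x - x') (y - y') (z - z') := by
  ext (j | j | j) <;> rfl

theorem zsmul_triple (m : ℤ) (x y : Fin 10 → ℝ) (z : Fin 2 → ℝ) :
    m • triple x y z = triple (m • x) (m • y) (m • z) := by
  ext (j | j | j) <;> rfl

theorem alphaA_nine : alphaA 9 = fun j => 1 / 10 - if j = Fin.last 9 then (1 : ℝ) else 0 := by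
  funext j
  simp only [alphaA]
  split_ifs <;> norm_num

theorem alphaA_one : alphaA 1 = ![1 / 2, -1 / 2] := by
  funext j
  fin_cases j <;> norm_num [alphaA, Fin.last]

theorem switchingRoot_eq : switchingRoot = triple 0 0 ![1, -1] := by
  rw [switchingRoot, alphaA_one]
  congr 1
  funext j
  fin_cases j <;> norm_num

theorem inner_switchingRoot_self : ⟪switchingRoot, switchingRoot⟫ = (2 : ℝ) := by
  rw [switchingRoot_eq, inner_triple]
  norm_num [Fin.sum_univ_two]

theorem mem_latticeL_triple {x y : Fin 10 → ℝ} {z : Fin 2 → ℝ} :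
    triple x y z ∈ latticeL ↔
      x ∈ rootLatticeA 9 ∧ y ∈ rootLatticeA 9 ∧ z ∈ rootLatticeA 1 := Iff.rfl

theorem sub_smul_alphaA_mem_iff {t : ℝ} (m : ℤ) (ht : t = m) (x : Fin 10 → ℝ) :
    x - t • alphaA 9 ∈ rootLatticeA 9 ↔
      ∃ a : Fin 10 → ℤ, ∑ j, a j = -m ∧ x = fun j => t / 10 + (a j : ℝ) := by
  have hmem : ∀ w : Fin 10 → ℝ, w ∈ rootLatticeA 9 ↔
    (∀ i, ∃ k : ℤ, w i = k) ∧ ∑ i, w i = 0 := fun w => Iff.rfl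
  rw [hmem, alphaA_nine]
  constructor
  · rintro ⟨h1, h2⟩
    choose k hk using h1
    have hx : ∀ j, x j = t / 10 + ((k j - if j = Fin.last 9 then m else 0 : ℤ) : ℝ) := by
      intro j
      have := hk j
      simp only [Pi.sub_apply, Pi.smul_apply, smul_eq_mul] at this
      subst ht
      by_cases hj : j = Fin.last 9
      · rw [if_pos hj] at this ⊢
        push_cast
        linarith
      · rw [if_neg hj] at this ⊢
        push_cast
        linarith
    refine ⟨fun j => k j - if j = Fin.last 9 then m else 0, ?_, funext hx⟩
    rw [Finset.sum_congr rfl fun j _ => hk j] at h2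
    have h3 : ∑ j, k j = 0 := by exact_mod_cast h2
    rw [Finset.sum_sub_distrib, h3]
    simp
  · rintro ⟨a, ha, rfl⟩
    have key : ∀ j, ((fun j => t / 10 + (a j : ℝ)) -
        t • fun j => 1 / 10 - if j = Fin.last 9 then (1 : ℝ) else 0) j =
        ((a j + if j = Fin.last 9 then m else 0 : ℤ) : ℝ) := by
      intro j
      simp only [Pi.sub_apply, Pi.smul_apply, smul_eq_mul]
      push_cast
      split_ifs <;> rw [ht] <;> ring
    refine ⟨fun j => ⟨_, key j⟩, ?_⟩
    rw [Finset.sum_congr rfl fun j _ => key j, ← Int.cast_sum, Finset.sum_add_distrib, ha]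
    simp

theorem sub_smul_alphaA_one_mem_iff (m : ℤ) (z : Fin 2 → ℝ) :
    z - m • alphaA 1 ∈ rootLatticeA 1 ↔
      ∃ c : ℤ, z = ![(m : ℝ) / 2 + c, -((m : ℝ) / 2 + c)] := by
  have hmem : ∀ w : Fin 2 → ℝ, w ∈ rootLatticeA 1 ↔
    (∀ i, ∃ k : ℤ, w i = k) ∧ ∑ i, w i = 0 := fun w => Iff.rfl
  rw [hmem, alphaA_one]
  constructor
  · rintro ⟨h1, h2⟩
    obtain ⟨c, hc⟩ := h1 0
    refine ⟨c, ?_⟩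
    simp [Fin.sum_univ_two] at hc h2
    funext j
    fin_cases j
    · simp
      linarith
    · simp
      linarith
  · rintro ⟨c, rfl⟩
    refine ⟨fun i => ?_, ?_⟩
    · fin_cases i
      · exact ⟨c, by simp; ring⟩
      · exact ⟨-c, by simp; ring⟩
    · simp [Fin.sum_univ_two]
      ring

theorem mem_latticeLambda_iff {γ : Space} :
    γ ∈ latticeLambda ↔ ∃ m : ℤ, γ - m • alphaVec ∈ latticeL := by
  rw [latticeLambda, AddSubgroup.mem_sup]
  constructor
  · rintro ⟨v, hv, w, hw, rfl⟩
    obtain ⟨m, rfl⟩ := AddSubgroup.mem_zmultiples_iff.1 hw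
    exact ⟨m, by simpa using hv⟩
  · rintro ⟨m, hm⟩
    exact ⟨_, hm, _, AddSubgroup.mem_zmultiples_iff.2 ⟨m, rfl⟩, by simp⟩

theorem mem_setX_iff {γ : Space} : γ ∈ setX ↔ ∃ m : ℤ, γ ∈ setXm m := by
  constructor
  · intro h
    obtain ⟨m, hm⟩ := mem_latticeLambda_iff.1 h.1
    exact ⟨m, h, hm⟩
  · rintro ⟨m, h, -⟩
    exact h

theorem sum_add_sq (t : ℝ) (a : Fin 10 → ℤ) :
    ∑ j, (t + (a j : ℝ)) * (t + (a j : ℝ)) =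
      10 * t ^ 2 + 2 * t * ((∑ j, a j : ℤ) : ℝ) + ((∑ j, a j ^ 2 : ℤ) : ℝ) := by
  have : ∀ j, (t + (a j : ℝ)) * (t + (a j : ℝ)) = t ^ 2 + 2 * t * (a j : ℝ) + (a j : ℝ) ^ 2 :=
    fun j => by ring
  simp only [this, Finset.sum_add_distrib, ← Finset.mul_sum]
  push_cast
  simp

/-- Inner product 1 with r fixes the last component at (1/2, -1/2), which forces m odd. Since Σa =
-m and Σb = -2m, the first two norms are Σa² - m²/10 and Σb² - 4m²/10, and norm 3 becomes the
displayed equation. -/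
theorem mem_setXm_iff {γ : Space} {m : ℤ} :
    γ ∈ setXm m ↔ Odd m ∧ ∃ a b : Fin 10 → ℤ, ∑ j, a j = -m ∧ ∑ j, b j = -(2 * m) ∧
      2 * (∑ j, a j ^ 2 + ∑ j, b j ^ 2) = m ^ 2 + 5 ∧
      γ = triple (fun j => (m : ℝ) / 10 + (a j : ℝ)) (fun j => (2 * m : ℝ) / 10 + (b j : ℝ))
        ![1 / 2, -(1 / 2)] := by
  have hcoset : ∀ x y z, triple x y z - m • alphaVec ∈ latticeL ↔
      (∃ a : Fin 10 → ℤ, ∑ j, a j = -m ∧ x = fun j => (m : ℝ) / 10 + (a j : ℝ)) ∧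
      (∃ b : Fin 10 → ℤ, ∑ j, b j = -(2 * m) ∧ y = fun j => (2 * m : ℝ) / 10 + (b j : ℝ)) ∧
      ∃ c : ℤ, z = ![(m : ℝ) / 2 + c, -((m : ℝ) / 2 + c)] := by
    intro x y z
    rw [alphaVec, zsmul_triple, triple_sub, mem_latticeL_triple, sub_smul_alphaA_one_mem_iff,
      ← sub_smul_alphaA_mem_iff (t := (m : ℝ)) m rfl,
      ← sub_smul_alphaA_mem_iff (t := (2 * m : ℝ)) (2 * m) (by push_cast; rfl),
      Int.cast_smul_eq_zsmul]
    have : m • (2 : ℝ) • alphaA 9 = (2 * m : ℝ) • alphaA 9 := by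
      rw [← Int.cast_smul_eq_zsmul ℝ, smul_smul, mul_comm]
    rw [this]
  have hnorm : ∀ a b : Fin 10 → ℤ, ∑ j, a j = -m → ∑ j, b j = -(2 * m) →
      (⟪triple (fun j => (m : ℝ) / 10 + (a j : ℝ)) (fun j => (2 * m : ℝ) / 10 + (b j : ℝ))
        ![1 / 2, -(1 / 2)], triple (fun j => (m : ℝ) / 10 + (a j : ℝ))
        (fun j => (2 * m : ℝ) / 10 + (b j : ℝ)) ![1 / 2, -(1 / 2)]⟫ = (3 : ℝ) ↔
      2 * (∑ j, a j ^ 2 + ∑ j, b j ^ 2) = m ^ 2 + 5) := by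
    intro a b ha hb
    rw [inner_triple, sum_add_sq, sum_add_sq, ha, hb, ← Int.cast_inj (α := ℝ)]
    push_cast
    simp only [Fin.sum_univ_two, Matrix.cons_val_zero, Matrix.cons_val_one]
    constructor <;> intro h <;> linarith
  constructor
  · rintro ⟨⟨-, h3, h1⟩, hm⟩
    rw [triple_eta γ, hcoset] at hm
    obtain ⟨⟨a, ha, hxa⟩, ⟨b, hb, hyb⟩, c, hzc⟩ := hm
    rw [triple_eta γ, hxa, hyb, hzc] at h1 h3 ⊢
    rw [switchingRoot_eq, inner_triple] at h1
    simp only [Pi.zero_apply, mul_zero, Finset.sum_const_zero, zero_add, Fin.sum_univ_two,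
      Matrix.cons_val_zero, Matrix.cons_val_one] at h1
    have hc : (m : ℝ) / 2 + c = 1 / 2 := by linarith
    rw [hc] at h3 ⊢
    refine ⟨⟨-c, ?_⟩, a, b, ha, hb, (hnorm a b ha hb).1 h3, rfl⟩
    have : (m : ℝ) = 2 * (-c) + 1 := by linarith
    exact_mod_cast this
  · rintro ⟨⟨c, hc⟩, a, b, ha, hb, hab, rfl⟩
    have hL : triple (fun j => (m : ℝ) / 10 + (a j : ℝ)) (fun j => (2 * m : ℝ) / 10 + (b j : ℝ))
        ![1 / 2, -(1 / 2)] - m • alphaVec ∈ latticeL := by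
      rw [hcoset]
      refine ⟨⟨a, ha, rfl⟩, ⟨b, hb, rfl⟩, -c, ?_⟩
      have : (m : ℝ) / 2 + ((-c : ℤ) : ℝ) = 1 / 2 := by
        rw [hc]
        push_cast
        ring
      rw [this]
    refine ⟨⟨mem_latticeLambda_iff.2 ⟨m, hL⟩, (hnorm a b ha hb).2 hab, ?_⟩, hL⟩
    rw [switchingRoot_eq, inner_triple]
    norm_num [Fin.sum_univ_two]

/-- This reflects 10α ∈ L: the same vector is rewritten with a shifted by k and b by 2k. -/
theorem mem_setXm_of_add {γ : Space} {m k : ℤ} (h : γ ∈ setXm (m + 10 * k)) : γ ∈ setXm m := by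
  refine ⟨h.1, ?_⟩
  obtain ⟨hm, a, b, ha, hb, hab, rfl⟩ := mem_setXm_iff.1 h
  refine (mem_setXm_iff.2 ⟨?_, fun j => a j + k, fun j => b j + 2 * k, ?_, ?_, ?_, ?_⟩).2
  · obtain ⟨c, hc⟩ := hm
    exact ⟨c - 5 * k, by linarith⟩
  · rw [Finset.sum_add_distrib, ha]
    simp
  · rw [Finset.sum_add_distrib, hb]
    simp
    ring
  · have h1 : ∀ j, (a j + k) ^ 2 = a j ^ 2 + 2 * k * a j + k ^ 2 := fun j => by ring
    have h2 : ∀ j, (b j + 2 * k) ^ 2 = b j ^ 2 + 4 * k * b j + 4 * k ^ 2 := fun j => by ring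
    simp only [h1, h2, Finset.sum_add_distrib, ← Finset.mul_sum, ha, hb]
    simp
    linarith
  · rw [triple_inj]
    refine ⟨funext fun j => ?_, funext fun j => ?_, rfl⟩
    · push_cast
      ring
    · push_cast
      ring

theorem switchingRoot_sub_mem_setXm {γ : Space} {m : ℤ} (h : γ ∈ setXm m) :
    switchingRoot - γ ∈ setXm (-m) := by
  obtain ⟨hm, a, b, ha, hb, hab, rfl⟩ := mem_setXm_iff.1 h
  refine mem_setXm_iff.2 ⟨hm.neg, -a, -b, by simp [ha], by simp [hb], by simpa using hab, ?_⟩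
  rw [switchingRoot_eq, triple_sub, triple_inj]
  refine ⟨funext fun j => ?_, funext fun j => ?_, funext fun j => ?_⟩
  · simp
    ring
  · simp
    ring
  · fin_cases j <;> norm_num

theorem sum_sq_add_nonneg (a : Fin 10 → ℤ) : 0 ≤ ∑ j, (a j ^ 2 + a j) :=
  Finset.sum_nonneg fun j _ => by
    rcases le_or_gt (a j) (-1) with h | h
    · nlinarith
    · have : 0 ≤ a j := h
      positivity

/-- Products of two consecutive integers are nonnegative. For m = 3 the sum of a(a + 1) and b(b + 1)
would be -2, and for m = 7 so would the sum of a(a + 1) and (b + 1)(b + 2). The case m = 9 is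
switched to -9 ≡ 1. -/
theorem setX_cases {γ : Space} (h : γ ∈ setX) :
    γ ∈ setXm 1 ∨ γ ∈ setXm 5 ∨ switchingRoot - γ ∈ setXm 1 := by
  obtain ⟨m, hm⟩ := mem_setX_iff.1 h
  have hodd := (mem_setXm_iff.1 hm).1
  have hmod : γ ∈ setXm (m % 10) := by
    refine mem_setXm_of_add (k := m / 10) ?_
    rwa [Int.emod_add_mul_ediv]
  have hs : m % 10 = 1 ∨ m % 10 = 3 ∨ m % 10 = 5 ∨ m % 10 = 7 ∨ m % 10 = 9 := by
    obtain ⟨c, rfl⟩ := hodd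
    omega
  have h2 : ∀ a : Fin 10 → ℤ, 0 ≤ ∑ j, (a j ^ 2 + 3 * a j + 2) := fun a =>
    Finset.sum_nonneg fun j _ => by
      rcases le_or_gt (a j) (-2) with h | h
      · nlinarith
      · have : -1 ≤ a j := h
        nlinarith
  rcases hs with hs | hs | hs | hs | hs <;> rw [hs] at hmod
  · exact Or.inl hmod
  · obtain ⟨-, a, b, ha, hb, hab, -⟩ := mem_setXm_iff.1 hmod
    have ha' := sum_sq_add_nonneg a
    have hb' := sum_sq_add_nonneg b
    rw [Finset.sum_add_distrib, ha] at ha'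
    rw [Finset.sum_add_distrib, hb] at hb'
    linarith
  · exact Or.inr (Or.inl hmod)
  · obtain ⟨-, a, b, ha, hb, hab, -⟩ := mem_setXm_iff.1 hmod
    have ha' := sum_sq_add_nonneg a
    have hb' := h2 b
    rw [Finset.sum_add_distrib, ha] at ha'
    rw [Finset.sum_add_distrib, Finset.sum_add_distrib, ← Finset.mul_sum, hb] at hb'
    simp at hb'
    linarith
  · right
    right
    exact mem_setXm_of_add (k := -1) (by simpa using switchingRoot_sub_mem_setXm hmod)

/-! ### Explicit vectors of X₁ and X₅ and their inner products. -/

/-- The vector of `X₁` given by a coordinate `i` and a pair `e`. -/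
noncomputable def edgeVector (i : Fin 10) (e : Finset (Fin 10)) : Space :=
  triple (fun j => 1 / 10 - if j = i then (1 : ℝ) else 0)
    (fun j => 1 / 5 - if j ∈ e then (1 : ℝ) else 0) ![1 / 2, -(1 / 2)]

/-- The vector of `X₅` given by a five-set. -/
noncomputable def fiveVector (S : Finset (Fin 10)) : Space :=
  triple (fun j => 1 / 2 - if j ∈ S then (1 : ℝ) else 0) 0 ![1 / 2, -(1 / 2)]

theorem eq_neg_indicator {a : Fin 10 → ℤ} (h : ∑ j, (a j ^ 2 + a j) = 0) :
    ∃ S : Finset (Fin 10), (S.card : ℤ) = -∑ j, a j ∧ ∀ j, a j = -if j ∈ S then 1 else 0 := by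
  have hn : ∀ j ∈ Finset.univ, 0 ≤ a j ^ 2 + a j := by
    intro j _
    rcases le_or_gt (a j) (-1) with h | h
    · nlinarith
    · have : 0 ≤ a j := h
      positivity
  have h0 := (Finset.sum_eq_zero_iff_of_nonneg hn).1 h
  have h1 : ∀ j, a j = -if j ∈ Finset.univ.filter (fun j => a j ≠ 0) then 1 else 0 := by
    intro j
    have h2 : a j * (a j + 1) = 0 := by linarith [h0 j (Finset.mem_univ _)]
    rcases mul_eq_zero.1 h2 with h3 | h3
    · simp [h3]
    · have h4 : a j = -1 := by linarith
      simp [h4]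
  refine ⟨Finset.univ.filter fun j => a j ≠ 0, ?_, h1⟩
  rw [Finset.sum_congr rfl fun j _ => h1 j, Finset.sum_neg_distrib, neg_neg, Finset.sum_boole]
  simp

/-- The sums of a² + a and b² + b add up to 3 - 1 - 2 = 0, so both vectors have entries 0 and -1
only, with supports of size 1 and 2. -/
theorem mem_setXm_one_iff {γ : Space} :
    γ ∈ setXm 1 ↔ ∃ i e, Finset.card e = 2 ∧ γ = edgeVector i e := by
  rw [mem_setXm_iff]
  constructor
  · rintro ⟨-, a, b, ha, hb, hab, rfl⟩
    have ha' := sum_sq_add_nonneg a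
    have hb' := sum_sq_add_nonneg b
    have ha'' : ∑ j, (a j ^ 2 + a j) = 0 := by
      rw [Finset.sum_add_distrib] at ha' hb' ⊢
      linarith
    have hb'' : ∑ j, (b j ^ 2 + b j) = 0 := by
      rw [Finset.sum_add_distrib] at ha' hb' ⊢
      linarith
    obtain ⟨S, hS, haS⟩ := eq_neg_indicator ha''
    obtain ⟨e, he, hbe⟩ := eq_neg_indicator hb''
    rw [ha] at hS
    rw [hb] at he
    obtain ⟨i, rfl⟩ := Finset.card_eq_one.1 (by omega : S.card = 1)
    refine ⟨i, e, by omega, ?_⟩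
    rw [edgeVector, triple_inj]
    refine ⟨funext fun j => ?_, funext fun j => ?_, rfl⟩
    · rw [haS]
      push_cast [Finset.mem_singleton]
      ring
    · rw [hbe]
      push_cast
      ring
  · rintro ⟨i, e, he, rfl⟩
    refine ⟨odd_one, fun j => -if j = i then 1 else 0, fun j => -if j ∈ e then 1 else 0,
      ?_, ?_, ?_, ?_⟩
    · simp
    · rw [Finset.sum_neg_distrib, Finset.sum_boole]
      simp [he]
    · simp [he]
    · rw [edgeVector, triple_inj]
      refine ⟨funext fun j => ?_, funext fun j => ?_, rfl⟩
      · push_cast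
        ring
      · push_cast
        ring

/-- Again 15 - 5 - 10 = 0 forces entries 0 and -1; the support of b has size 10, so b is constant
and the second component vanishes. -/
theorem mem_setXm_five_iff {γ : Space} :
    γ ∈ setXm 5 ↔ ∃ S, Finset.card S = 5 ∧ γ = fiveVector S := by
  rw [mem_setXm_iff]
  constructor
  · rintro ⟨-, a, b, ha, hb, hab, rfl⟩
    have ha' := sum_sq_add_nonneg a
    have hb' := sum_sq_add_nonneg b
    have ha'' : ∑ j, (a j ^ 2 + a j) = 0 := by
      rw [Finset.sum_add_distrib] at ha' hb' ⊢
      linarith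
    have hb'' : ∑ j, (b j ^ 2 + b j) = 0 := by
      rw [Finset.sum_add_distrib] at ha' hb' ⊢
      linarith
    obtain ⟨S, hS, haS⟩ := eq_neg_indicator ha''
    obtain ⟨e, he, hbe⟩ := eq_neg_indicator hb''
    rw [ha] at hS
    rw [hb] at he
    have heu : e = Finset.univ := by
      rw [← Finset.card_eq_iff_eq_univ, Fintype.card_fin]
      omega
    refine ⟨S, by omega, ?_⟩
    rw [fiveVector, triple_inj]
    refine ⟨funext fun j => ?_, funext fun j => ?_, rfl⟩
    · rw [haS]
      push_cast
      ring
    · rw [hbe, heu]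
      norm_num
  · rintro ⟨S, hS, rfl⟩
    refine ⟨by decide, fun j => -if j ∈ S then 1 else 0, fun j => -1, ?_, ?_, ?_, ?_⟩
    · rw [Finset.sum_neg_distrib, Finset.sum_boole]
      simp [hS]
    · simp
    · simp [hS]
    · rw [fiveVector, triple_inj]
      refine ⟨funext fun j => ?_, funext fun j => ?_, rfl⟩
      · push_cast
        ring
      · norm_num

theorem sum_sub_indicator_mul (s t : ℝ) (S T : Finset (Fin 10)) :
    ∑ j, (s - if j ∈ S then (1 : ℝ) else 0) * (t - if j ∈ T then (1 : ℝ) else 0) =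
      10 * s * t - s * T.card - t * S.card + (S ∩ T).card := by
  have h : ∀ j, (s - if j ∈ S then (1 : ℝ) else 0) * (t - if j ∈ T then (1 : ℝ) else 0) =
      s * t - s * (if j ∈ T then (1 : ℝ) else 0) - t * (if j ∈ S then (1 : ℝ) else 0) +
        if j ∈ S ∩ T then (1 : ℝ) else 0 := by
    intro j
    by_cases h1 : j ∈ S <;> by_cases h2 : j ∈ T <;> simp [h1, h2] <;> ring
  simp only [h, Finset.sum_add_distrib, Finset.sum_sub_distrib, ← Finset.mul_sum,
    Finset.sum_boole, Finset.filter_mem_eq_inter, Finset.univ_inter]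
  simp
  ring

theorem inner_edgeVector (i j : Fin 10) {e f : Finset (Fin 10)} (he : e.card = 2)
    (hf : f.card = 2) :
    ⟪edgeVector i e, edgeVector j f⟫ = (if i = j then (1 : ℝ) else 0) + (e ∩ f).card := by
  rw [edgeVector, edgeVector, inner_triple]
  have h := sum_sub_indicator_mul (1 / 10) (1 / 10) {i} {j}
  simp only [Finset.mem_singleton, Finset.card_singleton] at h
  rw [h, sum_sub_indicator_mul, he, hf]
  have h' : ((({i} : Finset (Fin 10)) ∩ {j}).card : ℝ) = if i = j then 1 else 0 := by
    split_ifs with h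
    · simp [h]
    · rw [Finset.singleton_inter_of_notMem (by simpa using h)]
      simp
  rw [h']
  simp only [Fin.sum_univ_two, Matrix.cons_val_zero, Matrix.cons_val_one]
  push_cast
  ring

theorem inner_fiveVector {S T : Finset (Fin 10)} (hS : S.card = 5) (hT : T.card = 5) :
    ⟪fiveVector S, fiveVector T⟫ = ((S ∩ T).card : ℝ) - 2 := by
  rw [fiveVector, fiveVector, inner_triple, sum_sub_indicator_mul, hS, hT]
  simp only [Fin.sum_univ_two, Matrix.cons_val_zero, Matrix.cons_val_one]
  simp
  ring

/-- The value is always 0 or 1, which is why sets in `X₁` and `X₅` can be combined without any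
compatibility condition. -/
theorem inner_edgeVector_fiveVector (i : Fin 10) (e : Finset (Fin 10)) {S : Finset (Fin 10)}
    (hS : S.card = 5) :
    ⟪edgeVector i e, fiveVector S⟫ = if i ∈ S then (1 : ℝ) else 0 := by
  rw [edgeVector, fiveVector, inner_triple]
  have h := sum_sub_indicator_mul (1 / 10) (1 / 2) {i} S
  simp only [Finset.mem_singleton, Finset.card_singleton] at h
  rw [h, hS]
  have h' : ((({i} : Finset (Fin 10)) ∩ S).card : ℝ) = if i ∈ S then 1 else 0 := by
    split_ifs with h
    · simp [h]
    · rw [Finset.singleton_inter_of_notMem h]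
      simp
  rw [h']
  simp only [Fin.sum_univ_two, Matrix.cons_val_zero, Matrix.cons_val_one]
  simp
  ring

theorem switchingRoot_sub_fiveVector (S : Finset (Fin 10)) :
    switchingRoot - fiveVector S = fiveVector Sᶜ := by
  rw [switchingRoot_eq, fiveVector, fiveVector, triple_sub, triple_inj]
  refine ⟨funext fun j => ?_, by simp, funext fun j => ?_⟩
  · by_cases h : j ∈ S <;> simp [h] <;> norm_num
  · fin_cases j <;> norm_num

theorem ite_mem_sub_inj {t : ℝ} {S T : Finset (Fin 10)}
    (h : (fun j => t - if j ∈ S then (1 : ℝ) else 0) = fun j => t - if j ∈ T then (1 : ℝ) else 0) :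
    S = T := by
  ext j
  have hj := congrFun h j
  rw [sub_right_inj] at hj
  by_cases hS : j ∈ S <;> by_cases hT : j ∈ T <;> simp [hS, hT] at hj ⊢

theorem fiveVector_injective : Function.Injective fiveVector := fun _ _ h =>
  ite_mem_sub_inj (triple_inj.1 h).1

theorem edgeVector_inj {i j : Fin 10} {e f : Finset (Fin 10)} :
    edgeVector i e = edgeVector j f ↔ i = j ∧ e = f := by
  refine ⟨fun h => ⟨?_, ite_mem_sub_inj (triple_inj.1 h).2.1⟩, fun h => by rw [h.1, h.2]⟩
  have := congrFun (triple_inj.1 h).1 i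
  by_contra hij
  simp [hij] at this

/-! ### Switching in affine equiangular sets. -/

theorem SwitchingEquivalent.mem_or_sub_mem {V : Type*} [AddCommGroup V] {r : V}
    {ω ω' : Set V} (h : SwitchingEquivalent r ω ω') {u : V} (hu : u ∈ ω) :
    u ∈ ω' ∨ r - u ∈ ω' := by
  obtain ⟨g, hg⟩ := h
  have hmem := (g ⟨u, hu⟩).2
  rcases hg ⟨u, hu⟩ with h | h <;> rw [h] at hmem
  · exact Or.inl hmem
  · exact Or.inr hmem

section General

variable {V : Type*} [NormedAddCommGroup V] [InnerProductSpace ℝ V] {r : V} {ω ω' Y Z : Set V}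

theorem IsAffineEquiangular.subset {s : ℝ} (h : IsAffineEquiangular s r ω) (hs : ω' ⊆ ω) :
    IsAffineEquiangular s r ω' :=
  ⟨h.one_le, h.root, h.finite.subset hs, fun u hu => h.inner_root u (hs hu),
    fun u hu => h.inner_self u (hs hu), fun u hu v hv => h.inner_ne u (hs hu) v (hs hv)⟩

theorem IsAffineEquiangular.inner_root_sub (h : IsAffineEquiangular 3 r ω) {u v : V} (hu : u ∈ ω) :
    ⟪u, r - v⟫ = 1 - ⟪u, v⟫ := by
  rw [inner_sub_right, h.inner_root u hu]

/-- The inner product of u with r - u is 1 - 3 = -2, which neither distinct nor equal members can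
have. -/
theorem IsAffineEquiangular.sub_notMem (h : IsAffineEquiangular 3 r ω) {u : V} (hu : u ∈ ω) :
    r - u ∉ ω := by
  intro hu'
  have h1 := h.inner_root_sub (v := u) hu
  rw [h.inner_self u hu] at h1
  by_cases he : u = r - u
  · rw [← he, h.inner_self u hu] at h1
    norm_num at h1
  · rcases h.inner_ne u hu _ hu' he with h2 | h2 <;> rw [h2] at h1 <;> norm_num at h1

open Classical in
/-- Switching the members of `ω` outside of `Z`. -/
noncomputable def switchInto (r : V) (Z : Set V) (u : V) : V := if u ∈ Z then u else r - u

theorem IsAffineEquiangular.switchInto_injOn (h : IsAffineEquiangular 3 r ω) (Z : Set V) :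
    Set.InjOn (switchInto r Z) ω := by
  intro u hu v hv huv
  unfold switchInto at huv
  split_ifs at huv with h1 h2 h2
  · exact huv
  · exact absurd (huv ▸ hu) (h.sub_notMem hv)
  · exact absurd (huv ▸ hv) (h.sub_notMem hu)
  · exact sub_right_injective huv

theorem IsAffineEquiangular.image_switchInto (h : IsAffineEquiangular 3 r ω) (Z : Set V) :
    IsAffineEquiangular 3 r (switchInto r Z '' ω) := by
  refine ⟨h.one_le, h.root, h.finite.image _, ?_, ?_, ?_⟩
  · rintro _ ⟨u, hu, rfl⟩
    unfold switchInto
    split_ifs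
    · exact h.inner_root u hu
    · rw [inner_sub_left, h.root, h.inner_root u hu]
      norm_num
  · rintro _ ⟨u, hu, rfl⟩
    unfold switchInto
    split_ifs
    · exact h.inner_self u hu
    · rw [inner_sub_left, inner_sub_right, inner_sub_right, h.root, h.inner_root u hu,
        real_inner_comm, h.inner_root u hu, h.inner_self u hu]
      norm_num
  · rintro _ ⟨u, hu, rfl⟩ _ ⟨v, hv, rfl⟩ hne
    have hne' : u ≠ v := fun e => hne (by rw [e])
    have huv := h.inner_ne u hu v hv hne'
    unfold switchInto
    split_ifs
    · exact huv
    · rw [h.inner_root_sub hu]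
      rcases huv with h1 | h1 <;> rw [h1] <;> norm_num
    · rw [real_inner_comm, h.inner_root_sub hv, real_inner_comm]
      rcases huv with h1 | h1 <;> rw [h1] <;> norm_num
    · rw [inner_sub_left, inner_sub_right, inner_sub_right, h.root, h.inner_root u hu,
        real_inner_comm, h.inner_root v hv]
      rcases huv with h1 | h1 <;> rw [h1] <;> norm_num

/-- Switching the members outside `ω'` is injective on `ω`, so the cardinality bound makes it a
bijection. -/
theorem IsAffineEquiangular.switchingEquivalent (h : IsAffineEquiangular 3 r ω) (hfin : ω'.Finite)
    (hcard : ω'.ncard ≤ ω.ncard) (hsub : ∀ u ∈ ω, u ∈ ω' ∨ r - u ∈ ω') :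
    SwitchingEquivalent r ω ω' := by
  have hmem : ∀ u : ω, switchInto r ω' u ∈ ω' := by
    intro u
    unfold switchInto
    split_ifs with h1
    · exact h1
    · exact (hsub u u.2).resolve_left h1
  let g : ω → ω' := fun u => ⟨switchInto r ω' u, hmem u⟩
  have hg : Function.Injective g := fun u v huv =>
    Subtype.ext (h.switchInto_injOn ω' u.2 v.2 (congrArg Subtype.val huv))
  have hfin' : Finite ω' := hfin
  have hbij : Function.Bijective g := hg.bijective_of_nat_card_le (by
    rwa [Nat.card_coe_set_eq, Nat.card_coe_set_eq])
  refine ⟨Equiv.ofBijective g hbij, fun u => ?_⟩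
  change switchInto r ω' u = u ∨ switchInto r ω' u = r - u
  unfold switchInto
  split_ifs
  · exact Or.inl rfl
  · exact Or.inr rfl

end General

/-! ### Sizes of maximum sets in X₁ and X₅, and the switching classes in X₅. -/

theorem isAffineEquiangular_of_subset_setX {ω : Set Space} (hω : ω ⊆ setX) (hfin : ω.Finite)
    (h : ∀ u ∈ ω, ∀ v ∈ ω, u ≠ v → ⟪u, v⟫ = (0 : ℝ) ∨ ⟪u, v⟫ = (1 : ℝ)) :
    IsAffineEquiangular 3 switchingRoot ω :=
  ⟨by norm_num, inner_switchingRoot_self, hfin, fun u hu => (hω hu).2.2, fun u hu => (hω hu).2.1, h⟩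

theorem setXm_subset_setX (m : ℤ) : setXm m ⊆ setX := fun _ h => h.1

theorem finite_setX : setX.Finite := by
  have h1 : (setXm 1).Finite := by
    refine (Set.finite_range fun p : Fin 10 × Finset (Fin 10) => edgeVector p.1 p.2).subset ?_
    intro γ hγ
    obtain ⟨i, e, -, rfl⟩ := mem_setXm_one_iff.1 hγ
    exact ⟨(i, e), rfl⟩
  have h5 : (setXm 5).Finite := by
    refine (Set.finite_range fiveVector).subset ?_
    intro γ hγ
    obtain ⟨S, -, rfl⟩ := mem_setXm_five_iff.1 hγ
    exact ⟨S, rfl⟩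
  refine ((h1.union h5).union (h1.image fun u => switchingRoot - u)).subset ?_
  intro γ hγ
  rcases setX_cases hγ with h | h | h
  · exact Or.inl (Or.inl h)
  · exact Or.inl (Or.inr h)
  · exact Or.inr ⟨_, h, sub_sub_cancel _ _⟩

theorem finite_maximumAES {Y : Set Space} (hY : Y ⊆ setX) :
    (maximumAES 3 switchingRoot Y).Finite :=
  finite_setX.finite_subsets.subset fun _ hω => hω.1.2.trans hY

/-- Two vectors with the same edge have inner product at least 2, so members are separated by their
edges, of which there are 45. -/
theorem ncard_le_of_subset_setXm_one {ω : Set Space} (h : IsAffineEquiangular 3 switchingRoot ω)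
    (hω : ω ⊆ setXm 1) : ω.ncard ≤ 45 := by
  choose! i e he hie using fun γ => (mem_setXm_one_iff (γ := γ)).1
  have h45 : ((((Finset.univ : Finset (Fin 10)).powersetCard 2 : Finset _) :
      Set (Finset (Fin 10)))).ncard = 45 := by
    rw [Set.ncard_coe_finset, Finset.card_powersetCard]
    decide
  rw [← h45]
  refine Set.ncard_le_ncard_of_injOn e (fun u hu => ?_) (fun u hu v hv huv => ?_)
    (Finset.finite_toSet _)
  · simpa using he u (hω hu)
  · by_contra hne
    have h2 := h.inner_ne u hu v hv hne
    rw [hie u (hω hu), hie v (hω hv), inner_edgeVector _ _ (he u (hω hu)) (he v (hω hv)), huv,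
      Finset.inter_self, he v (hω hv)] at h2
    split_ifs at h2 <;> norm_num at h2

open Classical in
/-- The five-sets of the members of `ω`. -/
noncomputable def fiveSets (ω : Set Space) : Finset (Finset (Fin 10)) :=
  Finset.univ.filter fun S => fiveVector S ∈ ω

theorem mem_fiveSets {ω : Set Space} {S : Finset (Fin 10)} :
    S ∈ fiveSets ω ↔ fiveVector S ∈ ω := by
  simp [fiveSets]

theorem card_of_fiveVector_mem {S : Finset (Fin 10)} (hS : fiveVector S ∈ setXm 5) :
    S.card = 5 := by
  obtain ⟨T, hT, h⟩ := mem_setXm_five_iff.1 hS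
  rwa [fiveVector_injective h]

theorem image_fiveSets {ω : Set Space} (hω : ω ⊆ setXm 5) : fiveVector '' (fiveSets ω) = ω := by
  ext γ
  constructor
  · rintro ⟨S, hS, rfl⟩
    exact mem_fiveSets.1 hS
  · intro hγ
    obtain ⟨S, -, rfl⟩ := mem_setXm_five_iff.1 (hω hγ)
    exact ⟨S, mem_fiveSets.2 hγ, rfl⟩

theorem card_fiveSets {ω : Set Space} (hω : ω ⊆ setXm 5) : (fiveSets ω).card = ω.ncard := by
  conv_rhs => rw [← image_fiveSets hω]
  rw [Set.ncard_image_of_injective _ fiveVector_injective, Set.ncard_coe_finset]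

/-- The five-sets of the members of `ω`, and their complements. -/
noncomputable def lineFamily (ω : Set Space) : Finset (Finset (Fin 10)) :=
  fiveSets ω ∪ (fiveSets ω).image compl

theorem mem_lineFamily {ω : Set Space} {S : Finset (Fin 10)} :
    S ∈ lineFamily ω ↔ fiveVector S ∈ ω ∨ switchingRoot - fiveVector S ∈ ω := by
  rw [lineFamily, Finset.mem_union, Finset.mem_image, mem_fiveSets, switchingRoot_sub_fiveVector]
  refine or_congr_right ⟨?_, fun h => ⟨_, mem_fiveSets.2 h, compl_compl S⟩⟩
  rintro ⟨T, hT, rfl⟩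
  rw [compl_compl]
  exact mem_fiveSets.1 hT

theorem isLineFamily_lineFamily {ω : Set Space} (h : IsAffineEquiangular 3 switchingRoot ω)
    (hω : ω ⊆ setXm 5) : IsLineFamily (lineFamily ω) ∧ (lineFamily ω).card = 2 * ω.ncard := by
  have h5 : ∀ S ∈ fiveSets ω, S.card = 5 := fun S hS =>
    card_of_fiveVector_mem (hω (mem_fiveSets.1 hS))
  rw [← card_fiveSets hω]
  refine isLineFamily_union_compl h5 fun S hS T hT hne => ?_
  have h1 := h.inner_ne _ (mem_fiveSets.1 hS) _ (mem_fiveSets.1 hT)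
    (fun e => hne (fiveVector_injective e).symm)
  rw [inner_fiveVector (h5 S hS) (h5 T hT)] at h1
  rcases h1 with h1 | h1
  · left
    have : ((S ∩ T).card : ℝ) = 2 := by linarith
    exact_mod_cast this
  · right
    have : ((S ∩ T).card : ℝ) = 3 := by linarith
    exact_mod_cast this

theorem ncard_le_of_subset_setXm_five {ω : Set Space} (h : IsAffineEquiangular 3 switchingRoot ω)
    (hω : ω ⊆ setXm 5) : ω.ncard ≤ 12 :=
  (isLineFamily_lineFamily h hω).1.card_le (isLineFamily_lineFamily h hω).2

theorem exists_lineFamily_eq {W : Finset (Finset (Fin 10))} (hW : IsLineFamily W)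
    (hc : W.card = 2 * 12) : ∃ ω, IsAffineEquiangular 3 switchingRoot ω ∧ ω ⊆ setXm 5 ∧
      ω.ncard = 12 ∧ lineFamily ω = W := by
  -- Membership of the point 0 selects one set from each complementary pair.
  have hmem : ∀ S ∈ W.filter (fun S => (0 : Fin 10) ∈ S), S.card = 5 := fun S hS =>
    hW.card_eq S (Finset.mem_filter.1 hS).1
  have hsub : fiveVector '' (W.filter fun S => (0 : Fin 10) ∈ S) ⊆ setXm 5 := by
    rintro _ ⟨S, hS, rfl⟩
    exact mem_setXm_five_iff.2 ⟨S, hmem S hS, rfl⟩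
  refine ⟨fiveVector '' (W.filter fun S => (0 : Fin 10) ∈ S), ?_, hsub, ?_, ?_⟩
  · refine isAffineEquiangular_of_subset_setX (hsub.trans (setXm_subset_setX 5))
      ((Finset.finite_toSet _).image _) ?_
    rintro _ ⟨S, hS, rfl⟩ _ ⟨T, hT, rfl⟩ hne
    rw [inner_fiveVector (hmem S hS) (hmem T hT)]
    have hS' := Finset.mem_filter.1 hS
    have hT' := Finset.mem_filter.1 hT
    rcases hW.inter S hS'.1 T hT'.1 (fun e => hne (by rw [e]))
      (fun e => Finset.mem_compl.1 (e ▸ hT'.2) hS'.2) with h | h <;> rw [h] <;> norm_num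
  · rw [Set.ncard_image_of_injective _ fiveVector_injective, Set.ncard_coe_finset]
    have := hW.sum_ind_eq hc 0
    simp only [ind, Finset.sum_boole] at this
    exact_mod_cast this
  · ext S
    rw [mem_lineFamily, switchingRoot_sub_fiveVector, fiveVector_injective.mem_set_image,
      fiveVector_injective.mem_set_image]
    simp only [Finset.coe_filter, Set.mem_ofPred_eq, Finset.mem_compl]
    constructor
    · rintro (h | h)
      · exact h.1
      · simpa using hW.compl_mem _ h.1
    · intro h
      by_cases h0 : (0 : Fin 10) ∈ S
      · exact Or.inl ⟨h, h0⟩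
      · exact Or.inr ⟨hW.compl_mem S h, h0⟩

theorem mem_maximumAES_setXm_five {ω : Set Space} :
    ω ∈ maximumAES 3 switchingRoot (setXm 5) ↔
      IsAffineEquiangular 3 switchingRoot ω ∧ ω ⊆ setXm 5 ∧ ω.ncard = 12 := by
  constructor
  · rintro ⟨⟨h1, h2⟩, h3⟩
    refine ⟨h1, h2, le_antisymm (ncard_le_of_subset_setXm_five h1 h2) ?_⟩
    have hne : lineFamilies.Nonempty := by
      rw [← Finset.card_pos, card_lineFamilies]
      norm_num
    obtain ⟨W, hW⟩ := hne
    obtain ⟨hW1, hW2⟩ := mem_lineFamilies.1 hW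
    obtain ⟨ω', h4, h5, h6, -⟩ := exists_lineFamily_eq hW1 hW2
    exact h6 ▸ h3 ω' h4 h5
  · rintro ⟨h1, h2, h3⟩
    exact ⟨⟨h1, h2⟩, fun ω' h4 h5 => h3 ▸ ncard_le_of_subset_setXm_five h4 h5⟩

/-- Since r - u corresponds to the complementary five-set, `lineFamily` is a complete invariant of
switching, and each family of twelve lines occurs. -/
theorem card_switchingClasses_setXm_five :
    Nat.card (SwitchingClasses switchingRoot (maximumAES 3 switchingRoot (setXm 5))) = 151200 := by
  have hmem : ∀ ω : maximumAES 3 switchingRoot (setXm 5), lineFamily ω.1 ∈ lineFamilies := by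
    intro ω
    obtain ⟨h1, h2, h3⟩ := mem_maximumAES_setXm_five.1 ω.2
    have h := isLineFamily_lineFamily h1 h2
    rw [h3] at h
    exact mem_lineFamilies.2 h
  have hle : ∀ ω ω' : Set Space, SwitchingEquivalent switchingRoot ω ω' →
      lineFamily ω ⊆ lineFamily ω' := by
    intro ω ω' h S hS
    rw [mem_lineFamily] at hS ⊢
    rcases hS with hS | hS
    · exact h.mem_or_sub_mem hS
    · have := h.mem_or_sub_mem hS
      rwa [sub_sub_cancel, or_comm] at this
  let F : SwitchingClasses switchingRoot (maximumAES 3 switchingRoot (setXm 5)) → lineFamilies :=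
    Quotient.lift (fun ω => ⟨lineFamily ω.1, hmem ω⟩) fun ω ω' h => Subtype.ext
      (Finset.Subset.antisymm (hle _ _ h)
        (hle _ _ ((switchingEquivalent_equivalence switchingRoot).symm h)))
  have hF : Function.Bijective F := by
    constructor
    · intro p q
      induction p using Quotient.inductionOn with | _ ω => ?_
      induction q using Quotient.inductionOn with | _ ω' => ?_
      intro h
      have h' : lineFamily ω.1 = lineFamily ω'.1 := congrArg Subtype.val h
      obtain ⟨h1, h2, h3⟩ := mem_maximumAES_setXm_five.1 ω.2
      obtain ⟨h1', h2', h3'⟩ := mem_maximumAES_setXm_five.1 ω'.2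
      refine Quotient.sound (h1.switchingEquivalent h1'.finite (by rw [h3, h3']) fun u hu => ?_)
      obtain ⟨S, -, rfl⟩ := mem_setXm_five_iff.1 (h2 hu)
      rw [← mem_lineFamily, ← h']
      exact mem_lineFamily.2 (Or.inl hu)
    · rintro ⟨W, hW⟩
      obtain ⟨hW1, hW2⟩ := mem_lineFamilies.1 hW
      obtain ⟨ω, h1, h2, h3, h4⟩ := exists_lineFamily_eq hW1 hW2
      exact ⟨Quotient.mk _ ⟨ω, mem_maximumAES_setXm_five.2 ⟨h1, h2, h3⟩⟩, Subtype.ext h4⟩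
  rw [Nat.card_eq_of_bijective F hF, Nat.card_eq_fintype_card, Fintype.card_coe,
    card_lineFamilies]

/-! ### Proper edge colourings as maximum sets in X₁. -/

/-- The vectors of `X₁` given by the coloured edges of `K₁₀`. -/
def coloringSet (c : Fin 10 → Fin 10 → Fin 10) : Set Space :=
  {γ | ∃ a b, a ≠ b ∧ γ = edgeVector (c a b) {a, b}}

theorem coloringSet_subset (c : Fin 10 → Fin 10 → Fin 10) : coloringSet c ⊆ setXm 1 := by
  rintro _ ⟨a, b, hab, rfl⟩
  exact mem_setXm_one_iff.2 ⟨_, _, Finset.card_pair hab, rfl⟩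

theorem IsProperColoring.eq_of_pair_eq {c : Fin 10 → Fin 10 → Fin 10} (hc : IsProperColoring c)
    {a b a' b' : Fin 10} (h : ({a, b} : Finset (Fin 10)) = {a', b'}) : c a b = c a' b' := by
  have h1 : ({a, b} : Set (Fin 10)) = {a', b'} := by
    have := congrArg (fun s : Finset (Fin 10) => (s : Set (Fin 10))) h
    simpa using this
  rcases Set.pair_eq_pair_iff.1 h1 with ⟨rfl, rfl⟩ | ⟨rfl, rfl⟩
  · rfl
  · exact hc.symm a b

theorem IsProperColoring.isAffineEquiangular {c : Fin 10 → Fin 10 → Fin 10}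
    (hc : IsProperColoring c) : IsAffineEquiangular 3 switchingRoot (coloringSet c) := by
  have hsub := (coloringSet_subset c).trans (setXm_subset_setX 1)
  refine isAffineEquiangular_of_subset_setX hsub (finite_setX.subset hsub) ?_
  rintro _ ⟨a, b, hab, rfl⟩ _ ⟨a', b', hab', rfl⟩ hne
  rw [inner_edgeVector _ _ (Finset.card_pair hab) (Finset.card_pair hab')]
  have hne' : ({a, b} : Finset (Fin 10)) ≠ {a', b'} := fun h =>
    hne (by rw [hc.eq_of_pair_eq h, h])
  have hproper : ∀ x y z, x ≠ y → x ≠ z → y ≠ z → c x y ≠ c x z := fun x y z h1 h2 h3 h =>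
    h3 (hc.proper x y z h1 h2 h)
  have hcases : ({a, b} : Finset (Fin 10)) ∩ {a', b'} = ∅ ∨
      (c a b ≠ c a' b' ∧ (({a, b} : Finset (Fin 10)) ∩ {a', b'}).card = 1) := by
    by_cases hemp : ({a, b} : Finset (Fin 10)) ∩ {a', b'} = ∅
    · exact Or.inl hemp
    · right
      constructor
      · intro hcc
        obtain ⟨x, hx⟩ := Finset.nonempty_iff_ne_empty.2 hemp
        simp only [Finset.mem_inter, Finset.mem_insert, Finset.mem_singleton] at hx
        rcases hx with ⟨rfl | rfl, rfl | rfl⟩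
        · exact hne' (by rw [hc.proper x b b' hab hab' hcc])
        · rw [hc.symm a'] at hcc
          exact hne' (by rw [hc.proper x b a' hab hab'.symm hcc, Finset.pair_comm])
        · rw [hc.symm a] at hcc
          exact hne' (by rw [hc.proper x a b' hab.symm hab' hcc, Finset.pair_comm])
        · rw [hc.symm a, hc.symm a'] at hcc
          exact hne' (by rw [hc.proper x a a' hab.symm hab'.symm hcc])
      · have h1 := Finset.card_pos.2 (Finset.nonempty_iff_ne_empty.2 hemp)
        have h2 : (({a, b} : Finset (Fin 10)) ∩ {a', b'}).card < 2 := by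
          refine lt_of_le_of_ne ?_ fun h => hne' ?_
          · rw [← Finset.card_pair hab]
            exact Finset.card_le_card Finset.inter_subset_left
          · have e1 := Finset.eq_of_subset_of_card_le
              (Finset.inter_subset_left (s₁ := ({a, b} : Finset (Fin 10))) (s₂ := {a', b'}))
              (by rw [h, Finset.card_pair hab])
            have e2 := Finset.eq_of_subset_of_card_le
              (Finset.inter_subset_right (s₁ := ({a, b} : Finset (Fin 10))) (s₂ := {a', b'}))
              (by rw [h, Finset.card_pair hab'])
            exact e1.symm.trans e2
        omega
  rcases hcases with h | ⟨h1, h2⟩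
  · rw [h, Finset.card_empty]
    split_ifs <;> simp
  · rw [if_neg h1, h2]
    simp

theorem ncard_coloringSet {c : Fin 10 → Fin 10 → Fin 10} (hc : IsProperColoring c) :
    45 ≤ (coloringSet c).ncard := by
  choose! i e he hie using fun γ => (mem_setXm_one_iff (γ := γ)).1
  have h45 : (((Finset.univ : Finset (Fin 10)).powersetCard 2 : Finset _) :
      Set (Finset (Fin 10))).ncard = 45 := by
    rw [Set.ncard_coe_finset, Finset.card_powersetCard]
    decide
  rw [← h45]
  refine (Set.ncard_le_ncard ?_ (hc.isAffineEquiangular.finite.image e)).trans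
    (Set.ncard_image_le hc.isAffineEquiangular.finite)
  intro f hf
  obtain ⟨a, b, hab, rfl⟩ := Finset.card_eq_two.1 (Finset.mem_powersetCard.1 hf).2
  have hmem : edgeVector (c a b) {a, b} ∈ coloringSet c := ⟨a, b, hab, rfl⟩
  exact ⟨_, hmem, (edgeVector_inj.1 (hie _ (coloringSet_subset c hmem))).2.symm⟩

theorem IsProperColoring.mem_maximumAES {c : Fin 10 → Fin 10 → Fin 10} (hc : IsProperColoring c) :
    coloringSet c ∈ maximumAES 3 switchingRoot (setXm 1) :=
  ⟨⟨hc.isAffineEquiangular, coloringSet_subset c⟩, fun _ h1 h2 =>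
    (ncard_le_of_subset_setXm_one h1 h2).trans (ncard_coloringSet hc)⟩

/-- The set records the colour of every edge; the fixed diagonal value makes the matrix unique. -/
theorem card_properColoring_le :
    Nat.card {c // IsProperColoring c} ≤ (maximumAES 3 switchingRoot (setXm 1)).ncard := by
  have hfin : Finite (maximumAES 3 switchingRoot (setXm 1)) :=
    finite_maximumAES (setXm_subset_setX 1)
  rw [← Nat.card_coe_set_eq]
  refine Nat.card_le_card_of_injective
    (fun c : {c // IsProperColoring c} => (⟨coloringSet c.1, c.2.mem_maximumAES⟩ :
      maximumAES 3 switchingRoot (setXm 1))) fun c c' h => Subtype.ext ?_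
  have h' : coloringSet c.1 = coloringSet c'.1 := congrArg Subtype.val h
  funext a b
  by_cases hab : a = b
  · rw [hab, c.2.diag, c'.2.diag]
  · have hmem : edgeVector (c.1 a b) {a, b} ∈ coloringSet c'.1 := h' ▸ ⟨a, b, hab, rfl⟩
    obtain ⟨a', b', -, h2⟩ := hmem
    rw [edgeVector_inj] at h2
    rw [h2.1, c'.2.eq_of_pair_eq h2.2]

theorem le_ncard_maximumAES_setXm_one :
    Nat.factorial 9 * numMatchings 10 * 6240 ≤
      (maximumAES 3 switchingRoot (setXm 1)).ncard := by
  refine le_trans ?_ (le_card_properColoring.trans card_properColoring_le)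
  rw [numMatchings_eq]
  -- The construction gives the larger factor 7680; only 6240 is needed.
  exact Nat.mul_le_mul_left _ (by norm_num)

/-! ### Combining the two parts. -/

theorem inner_setXm_one_five {u v : Space} (hu : u ∈ setXm 1) (hv : v ∈ setXm 5) :
    ⟪u, v⟫ = (0 : ℝ) ∨ ⟪u, v⟫ = (1 : ℝ) := by
  obtain ⟨i, e, -, rfl⟩ := mem_setXm_one_iff.1 hu
  obtain ⟨S, hS, rfl⟩ := mem_setXm_five_iff.1 hv
  rw [inner_edgeVector_fiveVector i e hS]
  split_ifs <;> simp

theorem disjoint_setXm_one_five : Disjoint (setXm 1) (setXm 5) := by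
  rw [Set.disjoint_left]
  intro u h1 h5
  have h := inner_setXm_one_five h1 h5
  rw [h1.1.2.1] at h
  norm_num at h

/-- The inner product of u with r - u is -2, whereas u has nonnegative inner product with everything
in `X₁` and `X₅`. -/
theorem switchingRoot_sub_notMem {u : Space} (hu : u ∈ setXm 1) :
    switchingRoot - u ∉ setXm 1 ∪ setXm 5 := by
  have h : ⟪u, switchingRoot - u⟫ = (-2 : ℝ) := by
    rw [inner_sub_right, hu.1.2.1, hu.1.2.2]
    norm_num
  rintro (h1 | h5)
  · obtain ⟨i, e, he, hie⟩ := mem_setXm_one_iff.1 hu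
    obtain ⟨j, f, hf, hjf⟩ := mem_setXm_one_iff.1 h1
    rw [hjf, hie, inner_edgeVector _ _ he hf] at h
    have h2 : (0 : ℝ) ≤ (e ∩ f).card := Nat.cast_nonneg _
    split_ifs at h <;> linarith
  · rcases inner_setXm_one_five hu h5 with h2 | h2 <;> rw [h] at h2 <;> norm_num at h2

theorem switchingRoot_sub_mem_setXm_five {u : Space} (hu : u ∈ setXm 5) :
    switchingRoot - u ∈ setXm 5 :=
  mem_setXm_of_add (k := -1) (by simpa using switchingRoot_sub_mem_setXm hu)

/-- Switching preserves the size and moves every member into `X₁ ∪ X₅`, where the bounds 45 and 12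
add. -/
theorem ncard_le_of_subset_setX {ω : Set Space} (h : IsAffineEquiangular 3 switchingRoot ω)
    (hω : ω ⊆ setX) : ω.ncard ≤ 57 := by
  set ω' := switchInto switchingRoot (setXm 1 ∪ setXm 5) '' ω with hω'
  have h' : IsAffineEquiangular 3 switchingRoot ω' := h.image_switchInto _
  have hsub : ω' ⊆ setXm 1 ∪ setXm 5 := by
    rintro _ ⟨u, hu, rfl⟩
    unfold switchInto
    split_ifs with h1
    · exact h1
    · rcases setX_cases (hω hu) with h2 | h2 | h2
      · exact absurd (Or.inl h2) h1
      · exact absurd (Or.inr h2) h1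
      · exact Or.inl h2
  have hcard : ω'.ncard = ω.ncard := (h.switchInto_injOn _).ncard_image
  have hunion : ω' = (ω' ∩ setXm 1) ∪ (ω' ∩ setXm 5) := by
    rw [← Set.inter_union_distrib_left, Set.inter_eq_left.2 hsub]
  have h1 := ncard_le_of_subset_setXm_one (h'.subset Set.inter_subset_left)
    (Set.inter_subset_right (s := ω') (t := setXm 1))
  have h5 := ncard_le_of_subset_setXm_five (h'.subset Set.inter_subset_left)
    (Set.inter_subset_right (s := ω') (t := setXm 5))
  have hle := Set.ncard_union_le (ω' ∩ setXm 1) (ω' ∩ setXm 5)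
  rw [← hunion, hcard] at hle
  linarith

theorem mem_maximumAES_setXm_one {ω : Set Space} :
    ω ∈ maximumAES 3 switchingRoot (setXm 1) ↔
      IsAffineEquiangular 3 switchingRoot ω ∧ ω ⊆ setXm 1 ∧ ω.ncard = 45 := by
  constructor
  · rintro ⟨⟨h1, h2⟩, h3⟩
    refine ⟨h1, h2, le_antisymm (ncard_le_of_subset_setXm_one h1 h2) ?_⟩
    have hpos : 0 < Nat.card {c // IsProperColoring c} := by
      refine lt_of_lt_of_le ?_ le_card_properColoring
      rw [Equiv.Perm.card_sq_eq_one_fin_ten]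
      positivity
    obtain ⟨⟨⟨c, hc⟩⟩, -⟩ := Nat.card_pos_iff.1 hpos
    exact (ncard_coloringSet hc).trans (h3 _ hc.isAffineEquiangular (coloringSet_subset c))
  · rintro ⟨h1, h2, h3⟩
    exact ⟨⟨h1, h2⟩, fun ω' h4 h5 => h3 ▸ ncard_le_of_subset_setXm_one h4 h5⟩

theorem union_mem_maximumAES {ω₁ ω₅ : Set Space}
    (h1 : ω₁ ∈ maximumAES 3 switchingRoot (setXm 1))
    (h5 : ω₅ ∈ maximumAES 3 switchingRoot (setXm 5)) :
    ω₁ ∪ ω₅ ∈ maximumAES 3 switchingRoot setX := by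
  obtain ⟨a1, s1, c1⟩ := mem_maximumAES_setXm_one.1 h1
  obtain ⟨a5, s5, c5⟩ := mem_maximumAES_setXm_five.1 h5
  have hsub : ω₁ ∪ ω₅ ⊆ setX := Set.union_subset (s1.trans (setXm_subset_setX 1))
    (s5.trans (setXm_subset_setX 5))
  refine ⟨⟨isAffineEquiangular_of_subset_setX hsub (a1.finite.union a5.finite) ?_, hsub⟩,
    fun ω' h h' => (ncard_le_of_subset_setX h h').trans ?_⟩
  · rintro u (hu | hu) v (hv | hv) hne
    · exact a1.inner_ne u hu v hv hne
    · exact inner_setXm_one_five (s1 hu) (s5 hv)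
    · rw [real_inner_comm]
      exact inner_setXm_one_five (s1 hv) (s5 hu)
    · exact a5.inner_ne u hu v hv hne
  · rw [Set.ncard_union_eq (disjoint_setXm_one_five.mono s1 s5) a1.finite a5.finite, c1, c5]

/-- Maximum sets in `X₁` and switching classes of maximum sets in `X₅` combine to switching
classes of maximum sets in `X`. -/
theorem mul_card_switchingClasses_le :
    (maximumAES 3 switchingRoot (setXm 1)).ncard *
        Nat.card (SwitchingClasses switchingRoot (maximumAES 3 switchingRoot (setXm 5))) ≤
      Nat.card (SwitchingClasses switchingRoot (maximumAES 3 switchingRoot setX)) := by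
  have hfin : Finite (maximumAES 3 switchingRoot setX) := finite_maximumAES subset_rfl
  rw [← Nat.card_coe_set_eq, ← Nat.card_prod]
  let F : maximumAES 3 switchingRoot (setXm 1) ×
      SwitchingClasses switchingRoot (maximumAES 3 switchingRoot (setXm 5)) →
      SwitchingClasses switchingRoot (maximumAES 3 switchingRoot setX) := fun p =>
    Quotient.mk _ ⟨p.1.1 ∪ p.2.out.1, union_mem_maximumAES p.1.2 p.2.out.2⟩
  refine Nat.card_le_card_of_injective F ?_
  -- A switching of the unions fixes the `X₁` part pointwise and keeps the `X₅` part inside `X₅`, so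
  -- it splits into an inclusion and a switching.
  have key : ∀ p q, F p = F q → p.1.1 ⊆ q.1.1 ∧
      SwitchingEquivalent switchingRoot p.2.out.1 q.2.out.1 := by
    intro p q h
    have hpq : SwitchingEquivalent switchingRoot (p.1.1 ∪ p.2.out.1) (q.1.1 ∪ q.2.out.1) :=
      Quotient.exact h
    obtain ⟨a1, s1, c1⟩ := mem_maximumAES_setXm_one.1 p.1.2
    obtain ⟨a5, s5, c5⟩ := mem_maximumAES_setXm_five.1 p.2.out.2
    obtain ⟨a1', s1', c1'⟩ := mem_maximumAES_setXm_one.1 q.1.2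
    obtain ⟨a5', s5', c5'⟩ := mem_maximumAES_setXm_five.1 q.2.out.2
    have hfive : ∀ u ∈ setXm 5, u ∈ q.1.1 ∪ q.2.out.1 → u ∈ q.2.out.1 := by
      rintro u hu (h | h)
      · exact absurd hu (Set.disjoint_left.1 disjoint_setXm_one_five (s1' h))
      · exact h
    constructor
    · intro u hu
      rcases hpq.mem_or_sub_mem (Or.inl hu) with h | h
      · exact h.resolve_right fun h' =>
          Set.disjoint_left.1 disjoint_setXm_one_five (s1 hu) (s5' h')
      · exact absurd (Set.union_subset_union s1' s5' h) (switchingRoot_sub_notMem (s1 hu))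
    · refine a5.switchingEquivalent a5'.finite (by rw [c5, c5']) fun u hu => ?_
      rcases hpq.mem_or_sub_mem (Or.inr hu) with h | h
      · exact Or.inl (hfive u (s5 hu) h)
      · exact Or.inr (hfive _ (switchingRoot_sub_mem_setXm_five (s5 hu)) h)
  intro p q h
  refine Prod.ext (Subtype.ext ?_) ?_
  · exact Set.Subset.antisymm (key p q h).1 (key q p h.symm).1
  · rw [← p.2.out_eq, ← q.2.out_eq]
    exact Quotient.sound (key p q h).2

theorem mainTheorem3 :
    3251173299978240000 ≤
        Nat.card (SwitchingClasses switchingRoot (maximumAES 3 switchingRoot setX)) ∧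
      Nat.card (SwitchingClasses switchingRoot (maximumAES 3 switchingRoot (setXm 5))) = 151200 ∧
      Nat.factorial 9 * numMatchings 10 * 6240 ≤
        (maximumAES 3 switchingRoot (setXm 1)).ncard ∧
      151200 * (Nat.factorial 9 * numMatchings 10 * 6240) = 3251173299978240000 := by
  have h4 : 151200 * (Nat.factorial 9 * numMatchings 10 * 6240) = 3251173299978240000 := by
    rw [numMatchings_ten]
    norm_num [Nat.factorial]
  refine ⟨?_, card_switchingClasses_setXm_five, le_ncard_maximumAES_setXm_one, h4⟩
  refine le_trans ?_ mul_card_switchingClasses_le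
  rw [card_switchingClasses_setXm_five, ← h4, mul_comm 151200]
  exact Nat.mul_le_mul_right _ le_ncard_maximumAES_setXm_one
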